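/- **Setting.** Let $f:\mathbb R^n\to\mathbb R$ be $C^2$ with $f\ge f_{\rm low}$ and $\{x: f(x)\le f(x_0)\}$ compact. $\|\cdot\|$ is the Euclidean or spectral norm, $\lambda_{\min}$ the smallest eigenvalue of a symmetric matrix, and $\mathrm{sgn}(t)=1$ for $t\ge 0$, $-1$ for $t<0$. **Algorithm** (inexact damped Newton-CG with line search). Inputs: $\epsilon_g,\epsilon_H>0$, $\theta\in(0,1)$, $\eta>0$, $U_H>0$, $\zeta\in(0,\min\{1,U_H\})$, $x_0\in\mathbb R^n$. At iteration $k=0,1,2,\dots$ a vector $g_k$ and a symmetric matrix $H_k$ with $\|H_k\|\le U_H$ are given. 1. If $\|g_k\|\ge\epsilon_g$, call Capped CG (below) with $H=H_k$, $g=g_k$, $\epsilon=\epsilon_H$, $M=U_H$, $\zeta$, to get a type and a vector $d$. * If the type is NC, put $d_k=-\mathrm{sgn}(d^Tg_k)\,\frac{|d^TH_kd|}{\|d\|^2}\,\frac{d}{\|d\|}$ and go to the line search. * If the type is SOL and $\|d\|>\epsilon_g/\epsilon_H$, put $d_k=d$ and go to the line search. * If the type is SOL and $\|d\|\le\epsilon_g/\epsilon_H$,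 call the minimum eigenvalue oracle for $(H_k,\epsilon_H)$. If it certifies $\lambda_{\min}(H_k)\ge-\epsilon_H$, terminate and return $x_k+d_k$ with $d_k=d$. If it gives $v$, change the type to NC, put $d_k=-\mathrm{sgn}(v^Tg_k)|v^TH_kv|\,v$ and go to the line search. 2. If $\|g_k\|<\epsilon_g$, call the minimum eigenvalue oracle for $(H_k,\epsilon_H)$. If it certifies $\lambda_{\min}(H_k)\ge-\epsilon_H$, terminate and return $x_k$. If it gives $v$, set the type to NC, put $d_k=-\mathrm{sgn}(v^Tg_k)|v^TH_kv|\,v$ and go to the line search. 3. Line search: $\alpha_k$ is the first element of $1,\theta,\theta^2,\dots$ (type SOL) or of $1,-1,\theta,-\theta,\theta^2,-\theta^2,\dots$ (type NC) with $f(x_k+\alpha_kd_k)<f(x_k)-\frac\eta6|\alpha_k|^3\|d_k\|^3$. Put $x_{k+1}=x_k+\alpha_kd_k$. *Minimum eigenvalue oracle* for $(H,\epsilon)$: a randomized procedure that gives either $v$ with $\|v\|=1$ and $v^THv\le-\epsilon/2$, or a certificate (possibly wrong) that $\lambda_{\min}(H)\ge-\epsilon$. If $\lambda_{\min}(H)<-\epsilon$,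 the probability, given everything known when it is called, that the certificate is issued is at most $\delta$, where $\delta\in[0,1)$ is fixed. *Capped CG* for $(H,g,\epsilon,M,\zeta)$: put $\bar H=H+2\epsilon I$, and, for the current $M$, $\kappa=\frac{M+2\epsilon}{\epsilon}$, $\hat\zeta=\frac{\zeta}{3\kappa}$, $\tau=\frac1{\sqrt\kappa+1}$, $T=\frac{4\kappa^4}{(1-\sqrt{1-\tau})^2}$. Start from $y_0=0$, $r_0=g$, $p_0=-g$. If $p_0^T\bar Hp_0<\epsilon\|p_0\|^2$, return (NC, $p_0$). Otherwise replace $M$ by $\|Hp_0\|/\|p_0\|$ if that is larger. For $j=1,2,\dots$ compute $y_j,r_j,p_j$ by the usual CG update: $\alpha=\frac{r_{j-1}^Tr_{j-1}}{p_{j-1}^T\bar Hp_{j-1}}$, $y_j=y_{j-1}+\alpha p_{j-1}$, $r_j=r_{j-1}+\alpha\bar Hp_{j-1}$, $p_j=-r_j+\frac{r_j^Tr_j}{r_{j-1}^Tr_{j-1}}p_{j-1}$. Replace $M$ by the maximum of $M$ and $\|Hw\|/\|w\|$, $w\in\{p_j,y_j,r_j\}$. Then, in this order: if $y_j^T\bar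 Hy_j\le\epsilon\|y_j\|^2$, return (NC, $y_j$); else if $\|r_j\|\le\hat\zeta\|r_0\|$, return (SOL, $y_j$); else if $p_j^T\bar Hp_j\le\epsilon\|p_j\|^2$, return (NC, $p_j$); else if $\|r_j\|\ge\sqrt T(1-\tau)^{j/2}\|r_0\|$, compute $y_{j+1}$ by the same update, find an $i\in\{0,\dots,j-1\}$ such that $u=y_{j+1}-y_i$ satisfies $u^T\bar Hu\le\epsilon\|u\|^2$, and return (NC, $u$). **Assumptions.** There is an open set $B$ containing the segments $[x_k,x_k+d_k]$, and also $[x_k,x_k-d_k]$ when the line search is bidirectional (type NC), for all iterates and search directions of the algorithm, on which $\nabla f$ and $\nabla^2f$ are Lipschitz continuous with constants $L_g,L_H>0$. At every iteration $k$ that is reached, $$\|g_k-\nabla f(x_k)\|\le\tfrac{1-\zeta}{8}\max\bigl(\epsilon_g,\min(\epsilon_H\|d_k\|,\|g_k\|,\|g_{k+1}\|)\bigr),\qquad \|H_k-\nabla^2f(x_k)\|\le\tfrac{1-\zeta}{4}\epsilon_H .$$ (At an iteration that terminates, the maximum is to be read as $\epsilon_g$, which is its value whatever $g_{k+1}$ is.)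 **Theorem 1.** There are absolute constants $C_1,C_2>0$ such that the following holds. Let $\epsilon>0$, $\epsilon_g=\epsilon$, $\epsilon_H=\sqrt{L_H\epsilon}$, and $$\bar K=\left\lceil\frac{3(f(x_0)-f_{\rm low})}{\min\left(\frac{1}{64L_H^{3/2}}c_{\rm sol},\,8L_H^{3/2}c_{\rm sol},\,L_H^{3/2}c_{\rm nc}/8\right)}\,\epsilon^{-3/2}\right\rceil+5,$$ $$c_{\rm sol}=\frac\eta6\min\left\{\frac1{(1+2L_H)^{3/2}},\left[\frac{3\theta^2(1-\zeta)}{4(L_H+\eta)}\right]^{3/2}\right\},\qquad c_{\rm nc}=\frac\eta6\min\left\{\left[\frac{3\theta}{2(L_H+\eta)}\right]^3,1\right\}.$$ Then the algorithm terminates within at most $\bar K$ iterations, at a point $x$ with $\|\nabla f(x)\|\le C_1\epsilon$. Moreover, with probability at least $(1-\delta)^{\bar K}$, the returned point also satisfies $\lambda_{\min}(\nabla^2f(x))\ge-C_2\sqrt{L_H\epsilon}$. -/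

import Mathlib

open MeasureTheory

/-- The space `ℝⁿ` with the Euclidean norm. -/
abbrev Vec (n : ℕ) := EuclideanSpace ℝ (Fin n)

/-- `n × n` real matrices, acting on `ℝⁿ`; the norm is the spectral (operator) norm. -/
abbrev Mat (n : ℕ) := Vec n →L[ℝ] Vec n

/-- The Hessian `∇²f(x)`: the derivative of the gradient. -/
noncomputable def hessian {n : ℕ} (f : Vec n → ℝ) (x : Vec n) : Mat n :=
  fderiv ℝ (gradient f) x

/-- `λ_min(A)`: the smallest eigenvalue of a symmetric matrix. -/
noncomputable def lambdaMin {n : ℕ} (A : Mat n) : ℝ :=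
  sInf {μ : ℝ | Module.End.HasEigenvalue (A : Vec n →ₗ[ℝ] Vec n) μ}

/-- The sign of a real number, always `1` or `-1` (the sign of `0` is `1`), so that a search
direction built from a nonzero vector is nonzero. -/
noncomputable def sgn (t : ℝ) : ℝ := if 0 ≤ t then 1 else -1

/-- The type of a direction: approximate Newton step (`SOL`) or negative curvature (`NC`). -/
inductive DType
  | SOL
  | NC

/-! ### Capped conjugate gradient -/

namespace CappedCG

noncomputable def kappa (M ε : ℝ) : ℝ := (M + 2 * ε) / ε

noncomputable def zetaHat (M ε ζ : ℝ) : ℝ := ζ / (3 * kappa M ε)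

noncomputable def tau (M ε : ℝ) : ℝ := 1 / (√(kappa M ε) + 1)

noncomputable def bigT (M ε : ℝ) : ℝ := 4 * kappa M ε ^ 4 / (1 - √(1 - tau M ε)) ^ 2

/-- `H̄ v = (H + 2 ε I) v`. -/
noncomputable def damped {n : ℕ} (H : Mat n) (ε : ℝ) (v : Vec n) : Vec n := H v + (2 * ε) • v

/-- The variables carried by the main loop. -/
structure State (n : ℕ) where
  y : Vec n
  r : Vec n
  p : Vec n
  M : ℝ

/-- The variables when the main loop is entered (`j = 0`). -/
noncomputable def init {n : ℕ} (H : Mat n) (g : Vec n) (M : ℝ) : State n where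
  y := 0
  r := g
  p := -g
  M := if M * ‖-g‖ < ‖H (-g)‖ then ‖H (-g)‖ / ‖-g‖ else M

/-- One conjugate gradient update, followed by the update of `M`. -/
noncomputable def next {n : ℕ} (H : Mat n) (ε : ℝ) (s : State n) : State n :=
  let α : ℝ := inner ℝ s.r s.r / inner ℝ s.p (damped H ε s.p)
  let y' : Vec n := s.y + α • s.p
  let r' : Vec n := s.r + α • damped H ε s.p
  let β : ℝ := inner ℝ r' r' / inner ℝ s.r s.r
  let p' : Vec n := -r' + β • s.p
  { y := y'
    r := r'
    p := p'
    M := max s.M (max (‖H p'‖ / ‖p'‖) (max (‖H y'‖ / ‖y'‖) (‖H r'‖ / ‖r'‖))) }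

/-- The variables after `j` updates. -/
noncomputable def state {n : ℕ} (H : Mat n) (g : Vec n) (ε M : ℝ) : ℕ → State n
  | 0 => init H g M
  | j + 1 => next H ε (state H g ε M j)

/-- The test `vᵀ H̄ v ≤ ε ‖v‖²`. -/
def LowCurv {n : ℕ} (H : Mat n) (ε : ℝ) (v : Vec n) : Prop :=
  inner ℝ v (damped H ε v) ≤ ε * ‖v‖ ^ 2

/-- The test `‖r_j‖ ≤ ζ̂ ‖r_0‖`. -/
def SmallRes {n : ℕ} (g : Vec n) (ε ζ : ℝ) (s : State n) : Prop :=
  ‖s.r‖ ≤ zetaHat s.M ε ζ * ‖g‖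

/-- The test `‖r_j‖ ≥ √T (1 - τ)^{j/2} ‖r_0‖`. -/
def SlowRes {n : ℕ} (g : Vec n) (ε : ℝ) (s : State n) (j : ℕ) : Prop :=
  √(bigT s.M ε) * (1 - tau s.M ε) ^ ((j : ℝ) / 2) * ‖g‖ ≤ ‖s.r‖

/-- The main loop is left at index `j`. -/
def Exit {n : ℕ} (H : Mat n) (g : Vec n) (ε ζ M : ℝ) (j : ℕ) : Prop :=
  let s := state H g ε M j
  LowCurv H ε s.y ∨ SmallRes g ε ζ s ∨ LowCurv H ε s.p ∨ SlowRes g ε s j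

/-- What may be returned when the main loop is left at index `j`. The index `i` in the last case
may be any index that passes the test. -/
inductive ExitWith {n : ℕ} (H : Mat n) (g : Vec n) (ε ζ M : ℝ) (j : ℕ) : DType → Vec n → Prop
  | lowCurvY (h₁ : LowCurv H ε (state H g ε M j).y) :
      ExitWith H g ε ζ M j DType.NC (state H g ε M j).y
  | solution (h₁ : ¬ LowCurv H ε (state H g ε M j).y)
      (h₂ : SmallRes g ε ζ (state H g ε M j)) :
      ExitWith H g ε ζ M j DType.SOL (state H g ε M j).y
  | lowCurvP (h₁ : ¬ LowCurv H ε (state H g ε M j).y)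
      (h₂ : ¬ SmallRes g ε ζ (state H g ε M j))
      (h₃ : LowCurv H ε (state H g ε M j).p) :
      ExitWith H g ε ζ M j DType.NC (state H g ε M j).p
  | slow (h₁ : ¬ LowCurv H ε (state H g ε M j).y)
      (h₂ : ¬ SmallRes g ε ζ (state H g ε M j))
      (h₃ : ¬ LowCurv H ε (state H g ε M j).p)
      (h₄ : SlowRes g ε (state H g ε M j) j)
      (i : ℕ) (hi : i < j)
      (h₅ : LowCurv H ε ((state H g ε M (j + 1)).y - (state H g ε M i).y)) :
      ExitWith H g ε ζ M j DType.NC ((state H g ε M (j + 1)).y - (state H g ε M i).y)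

/-- `Returns H g ε ζ M t d`: the procedure, called with these inputs, can terminate with
direction type `t` and direction `d`. -/
inductive Returns {n : ℕ} (H : Mat n) (g : Vec n) (ε ζ M : ℝ) : DType → Vec n → Prop
  | early (h : inner ℝ (-g) (damped H ε (-g)) < ε * ‖-g‖ ^ 2) :
      Returns H g ε ζ M DType.NC (-g)
  | loop (h : ¬ inner ℝ (-g) (damped H ε (-g)) < ε * ‖-g‖ ^ 2)
      (j : ℕ) (hj : 1 ≤ j) (hfirst : ∀ i, 1 ≤ i → i < j → ¬ Exit H g ε ζ M i)
      (t : DType) (d : Vec n) (hd : ExitWith H g ε ζ M j t d) :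
      Returns H g ε ζ M t d

/-- `some (t, d)` records an output of the procedure, `none` that it never terminates. -/
def IsOutput {n : ℕ} (H : Mat n) (g : Vec n) (ε ζ M : ℝ) : Option (DType × Vec n) → Prop
  | some (t, d) => Returns H g ε ζ M t d
  | none => ∀ t d, ¬ Returns H g ε ζ M t d

end CappedCG

/-- The answers a minimum eigenvalue oracle may give for `H` and `ε`: a unit vector `v` with
`vᵀ H v ≤ -ε/2`, or (`none`) a certificate, possibly a wrong one, that `λ_min(H) ≥ -ε`. -/
def IsMEOAnswer {n : ℕ} (H : Mat n) (ε : ℝ) : Option (Vec n) → Prop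
  | some v => ‖v‖ = 1 ∧ inner ℝ v (H v) ≤ -ε / 2
  | none => True

/-! ### Inexact damped Newton-CG with line search -/

namespace NewtonCG

/-- Scalar inputs of the algorithm. -/
structure Params where
  εg : ℝ
  εH : ℝ
  θ : ℝ
  η : ℝ
  UH : ℝ
  ζ : ℝ
  εg_pos : 0 < εg
  εH_pos : 0 < εH
  θ_pos : 0 < θ
  θ_lt_one : θ < 1
  η_pos : 0 < η
  UH_pos : 0 < UH
  ζ_pos : 0 < ζ
  ζ_lt : ζ < min 1 UH

/-- What the algorithm receives in the course of a run: at iteration `k` the approximate gradient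
`g k`, the approximate Hessian `H k`, the output `cg k` of the capped conjugate gradient procedure
and the answer `meo k` of the minimum eigenvalue oracle. Entries that the run never asks for are
irrelevant. -/
structure Data (n : ℕ) where
  g : ℕ → Vec n
  H : ℕ → Mat n
  cg : ℕ → Option (DType × Vec n)
  meo : ℕ → Option (Vec n)

/-- What an iteration has decided before the line search: search along `d` with type `t`;
terminate and return `x + d`; terminate and return `x`; or hang in a procedure that does not
terminate. -/
inductive Decision (n : ℕ)
  | search (t : DType) (d : Vec n)
  | stopAfter (d : Vec n)
  | stopHere
  | hang

/-- `-sgn(dᵀg) (|dᵀ H d| / ‖d‖²) d / ‖d‖`. -/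
noncomputable def ncDirection {n : ℕ} (g : Vec n) (H : Mat n) (d : Vec n) : Vec n :=
  (-(sgn (inner ℝ d g) * (|inner ℝ d (H d)| / ‖d‖ ^ 2))) • (‖d‖⁻¹ • d)

/-- `-sgn(vᵀg) |vᵀ H v| v`. -/
noncomputable def meoDirection {n : ℕ} (g : Vec n) (H : Mat n) (v : Vec n) : Vec n :=
  (-(sgn (inner ℝ v g) * |inner ℝ v (H v)|)) • v

/-- The part of an iteration that precedes the line search. -/
noncomputable def decision {n : ℕ} (prm : Params) (g : Vec n) (H : Mat n)
    (cg : Option (DType × Vec n)) (meo : Option (Vec n)) : Decision n :=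
  if prm.εg ≤ ‖g‖ then
    match cg with
    | none => Decision.hang
    | some (DType.NC, d) => Decision.search DType.NC (ncDirection g H d)
    | some (DType.SOL, d) =>
      if ‖d‖ ≤ prm.εg / prm.εH then
        match meo with
        | none => Decision.stopAfter d
        | some v => Decision.search DType.NC (meoDirection g H v)
      else Decision.search DType.SOL d
  else
    match meo with
    | none => Decision.stopHere
    | some v => Decision.search DType.NC (meoDirection g H v)

/-- The iteration calls the minimum eigenvalue oracle. -/
def CallsMEO {n : ℕ} (prm : Params) (g : Vec n) (cg : Option (DType × Vec n)) : Prop :=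
  ‖g‖ < prm.εg ∨ ∃ d, cg = some (DType.SOL, d) ∧ ‖d‖ ≤ prm.εg / prm.εH

/-- The sufficient decrease condition for the step `α` along `d`. -/
def Accept {n : ℕ} (f : Vec n → ℝ) (η : ℝ) (x d : Vec n) (α : ℝ) : Prop :=
  f (x + α • d) < f x - η / 6 * |α| ^ 3 * ‖d‖ ^ 3

/-- The steps tried by the line search: `1, θ, θ², …` for `SOL` and
`1, -1, θ, -θ, θ², -θ², …` for `NC`. -/
noncomputable def trialStep (θ : ℝ) : DType → ℕ → ℝ
  | DType.SOL, j => θ ^ j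
  | DType.NC, j => if Even j then θ ^ (j / 2) else -θ ^ (j / 2)

open Classical in
/-- The first accepted trial step; `none` if the line search never ends. -/
noncomputable def lineSearch {n : ℕ} (f : Vec n → ℝ) (prm : Params) (x : Vec n) (t : DType)
    (d : Vec n) : Option ℝ :=
  if h : ∃ j, Accept f prm.η x d (trialStep prm.θ t j) then
    some (trialStep prm.θ t (Nat.find h))
  else none

/-- Status of a run: at iterate `x`, terminated with result `x`, or stuck in a loop. -/
inductive Status (n : ℕ)
  | running (x : Vec n)
  | returned (x : Vec n)
  | hung

/-- One iteration from the iterate `x`. -/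
noncomputable def iteration {n : ℕ} (f : Vec n → ℝ) (prm : Params) (x : Vec n) :
    Decision n → Status n
  | Decision.search t d =>
    match lineSearch f prm x t d with
    | some α => Status.running (x + α • d)
    | none => Status.hung
  | Decision.stopAfter d => Status.returned (x + d)
  | Decision.stopHere => Status.returned x
  | Decision.hang => Status.hung

/-- The decision taken at iteration `k` (meaningful if the run reaches iteration `k`). -/
noncomputable def Data.decisionAt {n : ℕ} (D : Data n) (prm : Params) (k : ℕ) : Decision n :=
  decision prm (D.g k) (D.H k) (D.cg k) (D.meo k)

/-- The status after `k` iterations. -/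
noncomputable def Data.status {n : ℕ} (D : Data n) (f : Vec n → ℝ) (prm : Params) (x₀ : Vec n) :
    ℕ → Status n
  | 0 => Status.running x₀
  | k + 1 =>
    match D.status f prm x₀ k with
    | Status.running x => iteration f prm x (D.decisionAt prm k)
    | Status.returned x => Status.returned x
    | Status.hung => Status.hung

/-- The run reaches iteration `k` and calls the minimum eigenvalue oracle there. -/
def Data.CallsMEOAt {n : ℕ} (D : Data n) (f : Vec n → ℝ) (prm : Params) (x₀ : Vec n) (k : ℕ) :
    Prop :=
  (∃ x, D.status f prm x₀ k = Status.running x) ∧ CallsMEO prm (D.g k) (D.cg k)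

/-- The data come from an execution of the algorithm: at every iteration reached, the approximate
Hessian is symmetric and bounded by the input `UH`, and the two procedures, where they are
called, respond as they may. -/
structure IsExecution {n : ℕ} (f : Vec n → ℝ) (prm : Params) (x₀ : Vec n) (D : Data n) : Prop where
  symm : ∀ k x, D.status f prm x₀ k = Status.running x → IsSelfAdjoint (D.H k)
  bound : ∀ k x, D.status f prm x₀ k = Status.running x → ‖D.H k‖ ≤ prm.UH
  cg : ∀ k x, D.status f prm x₀ k = Status.running x → prm.εg ≤ ‖D.g k‖ →
    CappedCG.IsOutput (D.H k) (D.g k) prm.εH prm.ζ prm.UH (D.cg k)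
  meo : ∀ k, D.CallsMEOAt f prm x₀ k → IsMEOAnswer (D.H k) prm.εH (D.meo k)

/-- The directions along which steps are tried or taken. A bidirectional line search tries both
`d` and `-d`. -/
def Decision.directions {n : ℕ} : Decision n → Set (Vec n)
  | Decision.search DType.SOL d => {d}
  | Decision.search DType.NC d => {d, -d}
  | Decision.stopAfter d => {d}
  | Decision.stopHere => ∅
  | Decision.hang => ∅

/-- `B` contains the segments `[x_k, x_k + d]` for all iterates and search directions. -/
def ContainsSegments {n : ℕ} (f : Vec n → ℝ) (prm : Params) (x₀ : Vec n) (D : Data n)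
    (B : Set (Vec n)) : Prop :=
  ∀ k x, D.status f prm x₀ k = Status.running x →
    ∀ d ∈ (D.decisionAt prm k).directions, segment ℝ x (x + d) ⊆ B

/-- Smoothness assumptions on `f`, with a lower bound `flow`, and Lipschitz constants
`Lg` and `LH` of the gradient and the Hessian on the open set `B`. -/
structure SmoothOn {n : ℕ} (f : Vec n → ℝ) (x₀ : Vec n) (flow : ℝ) (B : Set (Vec n))
    (Lg LH : ℝ) : Prop where
  smooth : ContDiff ℝ 2 f
  lower : ∀ x, flow ≤ f x
  compact : IsCompact {x | f x ≤ f x₀}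
  isOpen : IsOpen B
  Lg_pos : 0 < Lg
  LH_pos : 0 < LH
  lipGrad : ∀ x ∈ B, ∀ y ∈ B, ‖gradient f x - gradient f y‖ ≤ Lg * ‖x - y‖
  lipHess : ∀ x ∈ B, ∀ y ∈ B, ‖hessian f x - hessian f y‖ ≤ LH * ‖x - y‖

/-- The quantity `max(εg, min(εH ‖d_k‖, ‖g_k‖, ‖g_{k+1}‖))`. At an iteration that terminates it
equals `εg` whatever `g_{k+1}` is, because then `‖g_k‖ < εg` or `εH ‖d_k‖ ≤ εg`. -/
noncomputable def gradTolerance {n : ℕ} (prm : Params) (D : Data n) (k : ℕ) : ℝ :=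
  match D.decisionAt prm k with
  | Decision.search _ d => max prm.εg (min (prm.εH * ‖d‖) (min ‖D.g k‖ ‖D.g (k + 1)‖))
  | _ => prm.εg

/-- Adaptive accuracy of the approximate gradients and Hessians at all iterations reached. -/
def Accurate {n : ℕ} (f : Vec n → ℝ) (prm : Params) (x₀ : Vec n) (D : Data n) : Prop :=
  ∀ k x, D.status f prm x₀ k = Status.running x →
    ‖D.g k - gradient f x‖ ≤ (1 - prm.ζ) / 8 * gradTolerance prm D k ∧
    ‖D.H k - hessian f x‖ ≤ (1 - prm.ζ) / 4 * prm.εH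

noncomputable def cSol (prm : Params) (LH : ℝ) : ℝ :=
  prm.η / 6 * min (1 / (1 + 2 * LH) ^ (3 / 2 : ℝ))
    ((3 * prm.θ ^ 2 * (1 - prm.ζ) / (4 * (LH + prm.η))) ^ (3 / 2 : ℝ))

noncomputable def cNC (prm : Params) (LH : ℝ) : ℝ :=
  prm.η / 6 * min ((3 * prm.θ / (2 * (LH + prm.η))) ^ 3) 1

/-- The iteration bound; `Δ` is `f(x₀) - flow`. -/
noncomputable def iterBound (prm : Params) (LH Δ ε : ℝ) : ℕ :=
  ⌈3 * Δ / min (1 / (64 * LH ^ (3 / 2 : ℝ)) * cSol prm LH)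
      (min (8 * LH ^ (3 / 2 : ℝ) * cSol prm LH) (LH ^ (3 / 2 : ℝ) * cNC prm LH / 8))
    * ε ^ (-(3 / 2) : ℝ)⌉₊ + 5

/-- The runs are random, indexed by `ω`, and every call of the minimum eigenvalue oracle fails
with probability at most `δ`. The σ-algebra `ℱ k` represents what is known when the call of
iteration `k` is due: it decides whether the call is made and determines the matrix `H k`; given
`ℱ k`, and if `λ_min(H k) < -εH`, the conditional probability that a certificate is issued is
at most `δ`. -/
structure OracleReliable {n : ℕ} {Ω : Type*} {mΩ : MeasurableSpace Ω} (P : Measure Ω)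
    (ℱ : Filtration ℕ mΩ) (f : Vec n → ℝ) (prm : Params) (x₀ : Vec n) (D : Ω → Data n) (δ : ℝ) :
    Prop where
  measurable_calls : ∀ k, MeasurableSet[ℱ k] {ω | (D ω).CallsMEOAt f prm x₀ k}
  measurable_H : ∀ k, Measurable[ℱ k] fun ω => (D ω).H k
  measurable_certified : ∀ k,
    MeasurableSet {ω | (D ω).CallsMEOAt f prm x₀ k ∧ (D ω).meo k = none}
  failure : ∀ k, ∀ᵐ ω ∂P, (D ω).CallsMEOAt f prm x₀ k → lambdaMin ((D ω).H k) < -prm.εH →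
    condExp (ℱ k) P
      ({ω' | (D ω').CallsMEOAt f prm x₀ k ∧ (D ω').meo k = none}.indicator fun _ => (1 : ℝ)) ω ≤ δ

end NewtonCG

/-! The proof is a potential argument. Every iteration that does not return lowers `f` by at least
`decreaseCoeff prm LH * ε ^ (3/2)`, and no iteration hangs, because Capped CG and the line search
both end (`iteration_cases`). Since `f` is bounded below, the run has returned by step `iterBound`
(`exists_returned`).

Decrease: NC directions are scaled so that `⟪d, H d⟫ = -‖d‖³` and `‖d‖ ≥ εH / 2`. Adding the cubic
Taylor bounds for `t` and `-t` cancels the slope, so both signs are rejected only if `t` is not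
small (`decrease_NC`). For a SOL step, orthogonality of residual and iterate gives `⟪d, g⟫ = -⟪d, H̄
d⟫`, a definite descent, and `‖d‖ > ε / εH` makes it large enough (`decrease_SOL`).

Capped CG: orthogonal nonzero residuals are at most `n` in number, so the loop is left. The delicate
point is that a slow residual forces low curvature along some `y (j+1) - y i`. If all these
curvatures `e i` were large, their tail sums would contract by `1 - 1/√κ`, hence so would the
residual bound (`residual_decay`), and the slow test would fail.

On return, the new gradient splits into small pieces (`norm_gradient_newtonStep_le`), and a correct
certificate for `H` passes to the Hessian by perturbation. A certificate ends the run, so at most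
one can be wrong. Each call errs with conditional probability at most `δ`, and the chances of no
error multiply to `(1 - δ)^K` (`exists_reliable_event`). -/

/-- The conjugate gradient recurrences for the quadratic `½ ⟪v, A v⟫ + ⟪g, v⟫`, started at `0`. -/
structure IsCGSequence {E : Type*} [NormedAddCommGroup E] [InnerProductSpace ℝ E]
    (A : E →ₗ[ℝ] E) (g : E) (α β : ℕ → ℝ) (y r p : ℕ → E) : Prop where
  y_zero : y 0 = 0
  r_zero : r 0 = g
  p_zero : p 0 = -g
  α_eq : ∀ j, α j = inner ℝ (r j) (r j) / inner ℝ (p j) (A (p j))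
  β_eq : ∀ j, β j = inner ℝ (r (j + 1)) (r (j + 1)) / inner ℝ (r j) (r j)
  y_succ : ∀ j, y (j + 1) = y j + α j • p j
  r_succ : ∀ j, r (j + 1) = r j + α j • A (p j)
  p_succ : ∀ j, p (j + 1) = -r (j + 1) + β j • p j

/-! ### Conjugate gradients: orthogonality and decay of the residual -/

namespace IsCGSequence

variable {E : Type*} [NormedAddCommGroup E] [InnerProductSpace ℝ E]
  {A : E →ₗ[ℝ] E} {g : E} {α β : ℕ → ℝ} {y r p : ℕ → E}

theorem r_eq (h : IsCGSequence A g α β y r p) (j : ℕ) : r j = g + A (y j) := by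
  induction j with
  | zero => simp [h.r_zero, h.y_zero]
  | succ j ih => rw [h.r_succ, h.y_succ, ih, map_add, map_smul, add_assoc]

/-- The first `j` steps are made along directions of positive curvature from nonzero residuals. -/
def Regular (A : E →ₗ[ℝ] E) (r p : ℕ → E) (j : ℕ) : Prop :=
  ∀ i < j, r i ≠ 0 ∧ 0 < inner ℝ (p i) (A (p i))

theorem Regular.mono {j k : ℕ} (hk : Regular A r p k) (hjk : j ≤ k) : Regular A r p j :=
  fun i hi => hk i (hi.trans_le hjk)

theorem α_pos (h : IsCGSequence A g α β y r p) {i : ℕ} (hr : r i ≠ 0)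
    (hp : 0 < inner ℝ (p i) (A (p i))) : 0 < α i := by
  rw [h.α_eq]
  exact div_pos (real_inner_self_pos.2 hr) hp

theorem α_mul (h : IsCGSequence A g α β y r p) {i : ℕ} (hp : 0 < inner ℝ (p i) (A (p i))) :
    α i * inner ℝ (p i) (A (p i)) = inner ℝ (r i) (r i) := by
  rw [h.α_eq, div_mul_cancel₀ _ hp.ne']

/-- One joint induction. A step along `p j`, conjugate to the earlier directions, keeps the residual
orthogonal to them; the residuals are combinations of directions; and `α i • A (p i) = r (i+1) - r
i` turns residual orthogonality into conjugacy of the next direction. -/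
theorem orthogonality (h : IsCGSequence A g α β y r p) (hA : A.IsSymmetric) (j : ℕ)
    (hj : Regular A r p j) :
    (∀ i < j, inner ℝ (r j) (p i) = 0 ∧ inner ℝ (r j) (r i) = 0 ∧ inner ℝ (p j) (A (p i)) = 0) ∧
      inner ℝ (r j) (p j) = -inner ℝ (r j) (r j) := by
  induction j with
  | zero => simp [h.r_zero, h.p_zero]
  | succ j ih =>
    obtain ⟨ih₁, ih₂⟩ := ih (hj.mono j.le_succ)
    obtain ⟨hrj, hpj⟩ := hj j j.lt_succ_self
    have hαj := h.α_pos hrj hpj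
    have hrp : ∀ i < j + 1, inner ℝ (r (j + 1)) (p i) = 0 := by
      intro i hi
      rw [h.r_succ, inner_add_left, real_inner_smul_left]
      rcases Nat.lt_succ_iff_lt_or_eq.1 hi with hi | rfl
      · rw [(ih₁ i hi).1, hA (p j) (p i), (ih₁ i hi).2.2]; simp
      · rw [ih₂, hA (p i) (p i), h.α_mul hpj]; ring
    have hrr : ∀ i < j + 1, inner ℝ (r (j + 1)) (r i) = 0 := by
      intro i hi
      rcases i with _ | i
      · have := hrp 0 hi
        rw [h.p_zero, inner_neg_right] at this
        rw [h.r_zero]; linarith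
      · have h₁ := hrp (i + 1) hi
        have h₂ := hrp i (by omega)
        rw [h.p_succ, inner_add_right, inner_neg_right, real_inner_smul_right, h₂] at h₁
        linarith
    refine ⟨fun i hi => ⟨hrp i hi, hrr i hi, ?_⟩, ?_⟩
    · obtain ⟨hri, hpi⟩ := hj i hi
      have hαi := h.α_pos hri hpi
      have key : α i * inner ℝ (r (j + 1)) (A (p i))
          = inner ℝ (r (j + 1)) (r (i + 1)) := by
        have := hrr i hi
        rw [h.r_succ i, inner_add_right, real_inner_smul_right, this, zero_add]
      rw [h.p_succ, inner_add_left, inner_neg_left, real_inner_smul_left]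
      rcases Nat.lt_succ_iff_lt_or_eq.1 hi with hi' | rfl
      · rw [hrr (i + 1) (by omega)] at key
        rw [(ih₁ i hi').2.2, (mul_eq_zero.1 key).resolve_left hαi.ne']; simp
      · have h₁ := h.α_mul hpi
        have h₂ : β i * inner ℝ (r i) (r i) = inner ℝ (r (i + 1)) (r (i + 1)) := by
          rw [h.β_eq, div_mul_cancel₀ _ (real_inner_self_pos.2 hri).ne']
        apply mul_left_cancel₀ hαi.ne'
        rw [mul_add, mul_neg, key, mul_left_comm, h₁, h₂]; ring
    · rw [h.p_succ, inner_add_right, inner_neg_right, real_inner_smul_right, hrp j j.lt_succ_self]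
      ring

/-- `⟪r i, p j⟫` does not depend on `i ≤ j`, since consecutive residuals differ by a multiple of `A
(p i)`, which is orthogonal to `p j`. -/
theorem inner_g_p (h : IsCGSequence A g α β y r p) (hA : A.IsSymmetric) {j : ℕ}
    (hj : Regular A r p j) : inner ℝ g (p j) = -inner ℝ (r j) (r j) := by
  have key : ∀ i ≤ j, inner ℝ (r i) (p j) = (inner ℝ g (p j) : ℝ) := by
    intro i
    induction i with
    | zero => simp [h.r_zero]
    | succ i ih =>
      intro hi
      rw [h.r_succ, inner_add_left, real_inner_smul_left, ih (by omega),
        real_inner_comm (p j) (A (p i)), ((h.orthogonality hA j hj).1 i hi).2.2]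
      simp
  rw [← key j le_rfl, (h.orthogonality hA j hj).2]

theorem inner_r_y_of_le (h : IsCGSequence A g α β y r p) (hA : A.IsSymmetric) {j : ℕ}
    (hj : Regular A r p j) {i : ℕ} (hi : i ≤ j) : inner ℝ (r j) (y i) = 0 := by
  induction i with
  | zero => simp [h.y_zero]
  | succ i ih =>
    rw [h.y_succ, inner_add_right, real_inner_smul_right, ih (by omega),
      ((h.orthogonality hA j hj).1 i hi).1]
    simp

/-- Each step adds `-α l * ‖r l‖² < 0`. This makes the iterates distinct, so differences of iterates
returned as NC directions are nonzero. -/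
theorem inner_g_y_lt (h : IsCGSequence A g α β y r p) (hA : A.IsSymmetric) {i j : ℕ}
    (hj : Regular A r p j) (hij : i < j) : inner ℝ g (y j) < inner ℝ g (y i) := by
  have step : ∀ l < j, inner ℝ g (y (l + 1)) < inner ℝ g (y l) := by
    intro l hl
    obtain ⟨hr, hp⟩ := hj l hl
    rw [h.y_succ, inner_add_right, real_inner_smul_right, h.inner_g_p hA (hj.mono hl.le)]
    have := mul_pos (h.α_pos hr hp) (real_inner_self_pos.2 hr)
    linarith
  induction j, hij using Nat.le_induction with
  | base => exact step i (Nat.lt_succ_self i)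
  | succ k hk ih =>
    exact (step k (Nat.lt_succ_self k)).trans
      (ih (hj.mono k.le_succ) fun l hl => step l (by omega))

/-- The curvature along `p i` is at most the curvature along the residual `r i`. -/
theorem curvature_p_le (h : IsCGSequence A g α β y r p) (hA : A.IsSymmetric) {j : ℕ}
    (hj : Regular A r p j) : inner ℝ (p j) (A (p j)) ≤ inner ℝ (r j) (A (r j)) := by
  rcases j with _ | j
  · simp [h.r_zero, h.p_zero]
  · have h₁ := ((h.orthogonality hA _ hj).1 j j.lt_succ_self).2.2
    have h₂ : inner ℝ (p j) (A (p (j + 1))) = (0 : ℝ) := by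
      rw [← hA, real_inner_comm, h₁]
    have h₃ := (hj j j.lt_succ_self).2
    -- The two terms are conjugate, so their curvatures add, and the one from `β j • p j` is
    -- nonnegative.
    have h₄ : r (j + 1) = -p (j + 1) + β j • p j := by rw [h.p_succ]; abel
    rw [h₄]
    simp only [map_add, map_neg, map_smul, inner_add_left, inner_add_right, inner_neg_left,
      inner_neg_right, real_inner_smul_left, real_inner_smul_right, h₁, h₂]
    nlinarith [mul_nonneg (mul_self_nonneg (β j)) h₃.le]

theorem inner_A_p_y_of_le (h : IsCGSequence A g α β y r p) (hA : A.IsSymmetric) {i m : ℕ}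
    (hi : Regular A r p i) (hm : m ≤ i) : inner ℝ (A (p i)) (y m) = 0 := by
  induction m with
  | zero => simp [h.y_zero]
  | succ m ih =>
    rw [h.y_succ, inner_add_right, real_inner_smul_right, ih (by omega), hA,
      ((h.orthogonality hA i hi).1 m hm).2.2]
    simp

/-- As `y m` is the sum of the `α l • p l` with `l < m`, conjugacy leaves only the term `l = i`. -/
theorem inner_A_p_y_of_lt (h : IsCGSequence A g α β y r p) (hA : A.IsSymmetric) {i m : ℕ}
    (hm : Regular A r p m) (him : i < m) : inner ℝ (A (p i)) (y m) = inner ℝ (r i) (r i) := by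
  induction m, him using Nat.le_induction with
  | base =>
    obtain ⟨hr, hp⟩ := hm i i.lt_succ_self
    rw [h.y_succ, inner_add_right, real_inner_smul_right,
      h.inner_A_p_y_of_le hA (hm.mono i.le_succ) le_rfl, hA, h.α_mul hp, zero_add]
  | succ k hk ih =>
    rw [h.y_succ, inner_add_right, real_inner_smul_right, ih (hm.mono k.le_succ),
      real_inner_comm (p k) (A (p i)), ((h.orthogonality hA k (hm.mono k.le_succ)).1 i hk).2.2]
    simp

/-- Both sides are twice the excess of the quadratic at `y i` over its value at `y m`. This linear
expression in `r i` is what allows telescoping and summation in `residual_decay`. -/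
theorem curvature_y_sub (h : IsCGSequence A g α β y r p) (hA : A.IsSymmetric) {i m : ℕ}
    (hm : Regular A r p m) (him : i ≤ m) :
    inner ℝ (y m - y i) (A (y m - y i)) = -inner ℝ (r i) (y m) := by
  have h₁ : A (y m - y i) = r m - r i := by rw [h.r_eq m, h.r_eq i, map_sub]; abel
  have h₂ := h.inner_r_y_of_le hA hm him
  have h₃ := h.inner_r_y_of_le hA hm le_rfl
  have h₄ := h.inner_r_y_of_le hA (hm.mono him) le_rfl
  rw [h₁, real_inner_comm]
  simp only [inner_sub_left, inner_sub_right, h₂, h₃, h₄]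
  ring

/-- The residuals are mutually orthogonal, so there are at most `finrank` nonzero ones. -/
theorem not_regular [FiniteDimensional ℝ E] (h : IsCGSequence A g α β y r p)
    (hA : A.IsSymmetric) : ¬ Regular A r p (Module.finrank ℝ E + 1) := by
  intro hreg
  let v : Fin (Module.finrank ℝ E + 1) → E := fun i => r i
  have hv : LinearIndependent ℝ v := by
    refine linearIndependent_of_ne_zero_of_inner_eq_zero (fun i => (hreg i i.2).1) ?_
    intro i j hij
    rcases lt_or_gt_of_ne hij with hlt | hlt
    · change inner ℝ (r i) (r j) = 0
      rw [real_inner_comm]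
      exact ((h.orthogonality hA j (hreg.mono j.2.le)).1 i hlt).2.1
    · exact ((h.orthogonality hA i (hreg.mono i.2.le)).1 j hlt).2.1
  have := hv.fintype_card_le_finrank
  simp at this

theorem norm_sum_r_sq (h : IsCGSequence A g α β y r p) (hA : A.IsSymmetric) {i m : ℕ}
    (hm : Regular A r p m) :
    ‖∑ l ∈ Finset.Ico i m, r l‖ ^ 2 = ∑ l ∈ Finset.Ico i m, inner ℝ (r l) (r l) := by
  rw [← real_inner_self_eq_norm_sq, sum_inner]
  refine Finset.sum_congr rfl fun a ha => ?_
  rw [inner_sum]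
  refine Finset.sum_eq_single_of_mem a ha fun b hb hba => ?_
  rw [Finset.mem_Ico] at ha hb
  rcases lt_or_gt_of_ne hba with hlt | hlt
  · exact ((h.orthogonality hA a (hm.mono ha.2.le)).1 b hlt).2.1
  · rw [real_inner_comm]
    exact ((h.orthogonality hA b (hm.mono hb.2.le)).1 a hlt).2.1

/-- If the curvature along `y m - y i` is at least `ε` for all `i < m`, then the residual decays
linearly, with the rate of the accelerated gradient method. -/
theorem residual_decay (h : IsCGSequence A g α β y r p) (hA : A.IsSymmetric) {J : ℕ}
    (hreg : Regular A r p (J + 1)) {L ε κ : ℝ} (hε : 0 < ε) (hκ : L = κ * ε) (hκ1 : 1 ≤ κ)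
    (hL : ∀ v, inner ℝ v (A v) ≤ L * ‖v‖ ^ 2)
    (hcurv : ∀ i ≤ J, ε * ‖y (J + 1) - y i‖ ^ 2 ≤
      inner ℝ (y (J + 1) - y i) (A (y (J + 1) - y i))) :
    ‖r J‖ ^ 2 ≤ κ * √κ * (1 - 1 / √κ) ^ J * ‖g‖ ^ 2 := by
  set w := y (J + 1) with hw
  -- The curvature along `w - y i`, that is, twice the gap in the quadratic between `y i` and `w`.
  set e : ℕ → ℝ := fun i => -inner ℝ (r i) w with he
  have hκ0 : 0 < κ := by linarith
  have hsκ : 1 ≤ √κ := Real.one_le_sqrt.2 hκ1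
  have hsκ2 : √κ ^ 2 = κ := Real.sq_sqrt hκ0.le
  have hL0 : 0 < L := hκ ▸ mul_pos hκ0 hε
  have hec : ∀ i ≤ J, ε * ‖w - y i‖ ^ 2 ≤ e i := fun i hi => by
    rw [he]; simp only
    rw [hw, ← h.curvature_y_sub hA hreg (by omega)]
    exact hcurv i hi
  have he0 : ∀ i ≤ J, 0 ≤ e i := fun i hi => le_trans (by positivity) (hec i hi)
  have heJ : e (J + 1) = 0 := by
    simp only [he, hw, h.inner_r_y_of_le hA hreg le_rfl, neg_zero]
  -- A step gains `α i * ‖r i‖²`, and `α i ≥ 1 / L` because the curvature along `p i` is at most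
  -- that along `r i`.
  have hdec : ∀ i ≤ J, inner ℝ (r i) (r i) ≤ L * (e i - e (i + 1)) := by
    intro i hi
    obtain ⟨hr, hp⟩ := hreg i (by omega)
    have h₁ : e i - e (i + 1) = α i * inner ℝ (r i) (r i) := by
      simp only [he]
      rw [h.r_succ, inner_add_left, real_inner_smul_left,
        h.inner_A_p_y_of_lt hA hreg (by omega)]
      ring
    have h₂ : inner ℝ (p i) (A (p i)) ≤ L * inner ℝ (r i) (r i) := by
      rw [real_inner_self_eq_norm_sq]
      exact (h.curvature_p_le hA (hreg.mono (by omega))).trans (hL _)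
    have h₃ := h.α_mul hp
    have h₄ := h.α_pos hr hp
    rw [h₁]
    nlinarith
  have htel : ∀ i ≤ J, ∑ l ∈ Finset.Ico i (J + 1), inner ℝ (r l) (r l) ≤ L * e i := by
    intro i hi
    calc ∑ l ∈ Finset.Ico i (J + 1), inner ℝ (r l) (r l)
        ≤ ∑ l ∈ Finset.Ico i (J + 1), L * (e l - e (l + 1)) :=
          Finset.sum_le_sum fun l hl => hdec l (by rw [Finset.mem_Ico] at hl; omega)
      _ = L * e i := by
          have := Finset.sum_Ico_sub (f := fun k => -e k) (show i ≤ J + 1 by omega)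
          simp only [neg_sub_neg, heJ] at this
          rw [← Finset.mul_sum, this]
          ring
  set S : ℕ → ℝ := fun i => ∑ l ∈ Finset.Ico i (J + 1), e l with hS
  have hS0 : ∀ i, 0 ≤ S i := fun i => Finset.sum_nonneg fun l hl =>
    he0 l (by rw [Finset.mem_Ico] at hl; omega)
  -- Cauchy–Schwarz for the summed residuals against `w - y i`. By Pythagoras and telescoping the
  -- first factor is at most `√(L * e i)`; by the curvature hypothesis the second is at most `√(e i
  -- / ε)`. The product is `√κ * e i`.
  have hSe : ∀ i ≤ J, S i ≤ √κ * e i := by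
    intro i hi
    have h₁ : S i = inner ℝ (∑ l ∈ Finset.Ico i (J + 1), r l) (-(w - y i)) := by
      rw [sum_inner]
      refine Finset.sum_congr rfl fun l hl => ?_
      rw [Finset.mem_Ico] at hl
      rw [inner_neg_right, inner_sub_right,
        h.inner_r_y_of_le hA (hreg.mono hl.2.le) hl.1, sub_zero]
    have h₂ : S i ≤ ‖∑ l ∈ Finset.Ico i (J + 1), r l‖ * ‖w - y i‖ := by
      rw [h₁]
      exact (real_inner_le_norm _ _).trans_eq (by rw [norm_neg])
    have h₃ : ‖∑ l ∈ Finset.Ico i (J + 1), r l‖ ^ 2 ≤ L * e i := by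
      rw [h.norm_sum_r_sq hA hreg]
      exact htel i hi
    have h₄ := hec i hi
    have h₅ : S i ^ 2 ≤ (√κ * e i) ^ 2 := by
      calc S i ^ 2 ≤ (‖∑ l ∈ Finset.Ico i (J + 1), r l‖ * ‖w - y i‖) ^ 2 :=
            pow_le_pow_left₀ (hS0 i) h₂ 2
        _ = ‖∑ l ∈ Finset.Ico i (J + 1), r l‖ ^ 2 * ‖w - y i‖ ^ 2 := mul_pow _ _ _
        _ ≤ L * e i * ‖w - y i‖ ^ 2 := by gcongr
        _ = κ * e i * (ε * ‖w - y i‖ ^ 2) := by rw [hκ]; ring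
        _ ≤ κ * e i * e i := by
            have := he0 i hi
            gcongr
        _ = (√κ * e i) ^ 2 := by rw [mul_pow, hsκ2]; ring
    exact le_of_sq_le_sq h₅ (mul_nonneg (by positivity) (he0 i hi))
  have hq : 0 ≤ 1 - 1 / √κ := by
    rw [sub_nonneg, div_le_one (by positivity)]; exact hsκ
  have hSstep : ∀ i ≤ J, S (i + 1) ≤ (1 - 1 / √κ) * S i := by
    intro i hi
    have h₁ : S i = e i + S (i + 1) := Finset.sum_eq_sum_Ico_succ_bot (by omega) e
    have h₂ : 1 / √κ * S i ≤ e i := by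
      rw [one_div, inv_mul_le_iff₀ (by positivity)]
      exact hSe i hi
    linarith
  have hSpow : ∀ i ≤ J, S i ≤ (1 - 1 / √κ) ^ i * S 0 := by
    intro i
    induction i with
    | zero => simp
    | succ i ih =>
      intro hi
      calc S (i + 1) ≤ (1 - 1 / √κ) * S i := hSstep i (by omega)
        _ ≤ (1 - 1 / √κ) * ((1 - 1 / √κ) ^ i * S 0) := by
            gcongr
            exact ih (by omega)
        _ = (1 - 1 / √κ) ^ (i + 1) * S 0 := by ring
  have heg : e 0 ≤ ‖g‖ ^ 2 / ε := by
    have h₁ : e 0 ≤ ‖g‖ * ‖w‖ := by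
      simp only [he]
      rw [h.r_zero, ← inner_neg_left]
      exact (real_inner_le_norm _ _).trans_eq (by rw [norm_neg])
    have h₂ := hec 0 (Nat.zero_le _)
    rw [h.y_zero, sub_zero] at h₂
    rw [le_div_iff₀ hε]
    have h₃ : ε * ‖w‖ ≤ ‖g‖ := by
      by_contra! hc
      have hw0 : 0 < ‖w‖ := by
        rcases (norm_nonneg w).eq_or_lt with h0 | h0
        · rw [← h0, mul_zero] at hc
          exact absurd hc (not_lt.2 (norm_nonneg g))
        · exact h0
      nlinarith
    nlinarith [norm_nonneg g]
  have hSJ : S J = e J := by simp [hS]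
  calc ‖r J‖ ^ 2 = inner ℝ (r J) (r J) := (real_inner_self_eq_norm_sq _).symm
    _ ≤ L * e J := by simpa [heJ] using hdec J le_rfl
    _ = L * S J := by rw [hSJ]
    _ ≤ L * ((1 - 1 / √κ) ^ J * (√κ * (‖g‖ ^ 2 / ε))) := by
        gcongr
        refine (hSpow J le_rfl).trans ?_
        gcongr
        refine (hSe 0 (Nat.zero_le _)).trans ?_
        gcongr
    _ = κ * √κ * (1 - 1 / √κ) ^ J * ‖g‖ ^ 2 := by
        rw [hκ]; field_simp

end IsCGSequence

/-! ### Capped CG: termination and properties of its output -/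

namespace CappedCG

variable {n : ℕ} {H : Mat n} {g : Vec n} {ε ζ M : ℝ}

/-- `H + 2 ε I` as a linear map. -/
noncomputable def dampedMap (H : Mat n) (ε : ℝ) : Vec n →ₗ[ℝ] Vec n :=
  (H : Vec n →ₗ[ℝ] Vec n) + (2 * ε) • LinearMap.id

@[simp]
theorem dampedMap_apply (H : Mat n) (ε : ℝ) (v : Vec n) : dampedMap H ε v = damped H ε v := rfl

theorem dampedMap_isSymmetric (hH : IsSelfAdjoint H) : (dampedMap H ε).IsSymmetric := by
  intro u v
  have := hH.isSymmetric u v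
  simp only [dampedMap_apply, damped, inner_add_left, inner_add_right, real_inner_smul_left,
    real_inner_smul_right]
  rw [show inner ℝ (H u) v = inner ℝ u (H v) from this]

theorem inner_damped (H : Mat n) (ε : ℝ) (v : Vec n) :
    inner ℝ v (damped H ε v) = inner ℝ v (H v) + 2 * ε * ‖v‖ ^ 2 := by
  rw [damped, inner_add_right, real_inner_smul_right, real_inner_self_eq_norm_sq]

theorem inner_damped_le (hM : ‖H‖ ≤ M) (v : Vec n) :
    inner ℝ v (damped H ε v) ≤ (M + 2 * ε) * ‖v‖ ^ 2 := by
  have h₁ : inner ℝ v (H v) ≤ ‖v‖ * ‖H v‖ := real_inner_le_norm _ _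
  have h₂ : ‖H v‖ ≤ M * ‖v‖ := H.le_of_opNorm_le hM v
  rw [inner_damped]
  nlinarith [norm_nonneg v]

theorem norm_damped_le (hε : 0 ≤ ε) (hM : ‖H‖ ≤ M) (v : Vec n) :
    ‖damped H ε v‖ ≤ (M + 2 * ε) * ‖v‖ := by
  have h₂ : ‖H v‖ ≤ M * ‖v‖ := H.le_of_opNorm_le hM v
  calc ‖damped H ε v‖ ≤ ‖H v‖ + ‖(2 * ε) • v‖ := norm_add_le _ _
    _ ≤ (M + 2 * ε) * ‖v‖ := by
        rw [norm_smul, Real.norm_of_nonneg (by positivity)]; linarith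

theorem lowCurv_iff {v : Vec n} : LowCurv H ε v ↔ inner ℝ v (H v) ≤ -ε * ‖v‖ ^ 2 := by
  rw [LowCurv, inner_damped]
  constructor <;> intro h <;> linarith

/-- The bound on `‖H‖` never changes if it is correct from the start. -/
theorem state_M (hM : ‖H‖ ≤ M) (j : ℕ) : (state H g ε M j).M = M := by
  have hM0 : 0 ≤ M := (norm_nonneg H).trans hM
  -- For `v = 0` the quotient is `0 / 0 = 0`, so `0 ≤ M` is needed.
  have hq : ∀ v, ‖H v‖ / ‖v‖ ≤ M := fun v =>
    div_le_of_le_mul₀ (norm_nonneg v) hM0 (H.le_of_opNorm_le hM v)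
  induction j with
  | zero => exact if_neg (not_lt.2 (H.le_of_opNorm_le hM _))
  | succ j ih =>
    simp only [state, next, ih]
    exact max_eq_left (max_le (hq _) (max_le (hq _) (hq _)))

theorem isCGSequence (H : Mat n) (g : Vec n) (ε M : ℝ) :
    IsCGSequence (dampedMap H ε) g
      (fun j => inner ℝ (state H g ε M j).r (state H g ε M j).r /
        inner ℝ (state H g ε M j).p (damped H ε (state H g ε M j).p))
      (fun j => inner ℝ (state H g ε M (j + 1)).r (state H g ε M (j + 1)).r /
        inner ℝ (state H g ε M j).r (state H g ε M j).r)
      (fun j => (state H g ε M j).y) (fun j => (state H g ε M j).r)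
      (fun j => (state H g ε M j).p) where
  y_zero := rfl
  r_zero := rfl
  p_zero := rfl
  α_eq _ := rfl
  β_eq _ := rfl
  y_succ _ := rfl
  r_succ _ := rfl
  p_succ _ := rfl

theorem two_le_kappa (hε : 0 < ε) (hM : 0 ≤ M) : 2 ≤ kappa M ε := by
  rw [kappa, le_div_iff₀ hε]; linarith

theorem zetaHat_nonneg (hε : 0 < ε) (hM : 0 ≤ M) (hζ : 0 ≤ ζ) : 0 ≤ zetaHat M ε ζ := by
  have := two_le_kappa hε hM
  rw [zetaHat]; positivity

theorem r_ne_zero_of_not_smallRes (hε : 0 < ε) (hM : 0 ≤ M) (hζ : 0 ≤ ζ) {s : State n}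
    (hs : s.M = M) (h : ¬ SmallRes g ε ζ s) : s.r ≠ 0 := by
  rintro h0
  apply h
  rw [SmallRes, h0, norm_zero, hs]
  exact mul_nonneg (zetaHat_nonneg hε hM hζ) (norm_nonneg g)

/-- As long as the loop is not left, the iterates are those of a regular conjugate gradient run. -/
theorem regular_of_not_exit (hε : 0 < ε) (hM : ‖H‖ ≤ M) (hζ : 0 ≤ ζ) (hg : g ≠ 0)
    (h0 : ¬ inner ℝ (-g) (damped H ε (-g)) < ε * ‖-g‖ ^ 2) {j : ℕ}
    (hj : ∀ i, 1 ≤ i → i < j → ¬ Exit H g ε ζ M i) :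
    IsCGSequence.Regular (dampedMap H ε) (fun j => (state H g ε M j).r)
      (fun j => (state H g ε M j).p) j := by
  have hM0 : 0 ≤ M := (norm_nonneg H).trans hM
  intro i hi
  rcases i with _ | i
  · refine ⟨hg, lt_of_lt_of_le ?_ (not_lt.1 h0)⟩
    have : 0 < ‖-g‖ := norm_pos_iff.2 (neg_ne_zero.2 hg)
    positivity
  · have := hj (i + 1) (by omega) hi
    simp only [Exit, not_or] at this
    refine ⟨r_ne_zero_of_not_smallRes hε hM0 hζ (state_M hM _) this.2.1, ?_⟩
    exact lt_of_le_of_lt (by positivity) (not_le.1 this.2.2.1)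

theorem y_sub_ne_zero {i j : ℕ} (hH : IsSelfAdjoint H)
    (hreg : IsCGSequence.Regular (dampedMap H ε) (fun j => (state H g ε M j).r)
      (fun j => (state H g ε M j).p) j) (hij : i < j) :
    (state H g ε M j).y - (state H g ε M i).y ≠ 0 := by
  intro h
  have := (isCGSequence H g ε M).inner_g_y_lt (dampedMap_isSymmetric hH) hreg hij
  rw [sub_eq_zero.1 h] at this
  exact lt_irrefl _ this

/-- Orthogonality gives `⟪r j, p j⟫ = -‖r j‖²`, which is nonzero. -/
theorem p_ne_zero {j : ℕ} (hH : IsSelfAdjoint H)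
    (hreg : IsCGSequence.Regular (dampedMap H ε) (fun j => (state H g ε M j).r)
      (fun j => (state H g ε M j).p) j) (hr : (state H g ε M j).r ≠ 0) :
    (state H g ε M j).p ≠ 0 := by
  intro h
  have := ((isCGSequence H g ε M).orthogonality (dampedMap_isSymmetric hH) j hreg).2
  simp only [h, inner_zero_right] at this
  exact hr (inner_self_eq_zero (𝕜 := ℝ).1 (by linarith))

/-- The residual cannot be slow without a difference of iterates of low curvature. -/
theorem exists_lowCurv_of_slowRes (hε : 0 < ε) (hM : ‖H‖ ≤ M) (hH : IsSelfAdjoint H)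
    (hg : g ≠ 0) {j : ℕ}
    (hreg : IsCGSequence.Regular (dampedMap H ε) (fun j => (state H g ε M j).r)
      (fun j => (state H g ε M j).p) (j + 1))
    (hp : ¬ LowCurv H ε (state H g ε M j).p) (hs : SlowRes g ε (state H g ε M j) j) :
    ∃ i < j, LowCurv H ε ((state H g ε M (j + 1)).y - (state H g ε M i).y) := by
  by_contra! hcon
  have hcg := isCGSequence H g ε M
  have hM0 : 0 ≤ M := (norm_nonneg H).trans hM
  have hκ := two_le_kappa hε hM0
  set κ := kappa M ε with hκdef
  have hdecay := hcg.residual_decay (dampedMap_isSymmetric hH) hreg (L := M + 2 * ε) hε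
    (κ := κ) (by rw [hκdef, kappa]; field_simp) (by linarith) (fun v => inner_damped_le hM v) (by
      intro i hi
      rcases hi.lt_or_eq with hi | rfl
      · exact (not_le.1 (hcon i hi)).le
      -- For `i = j` the difference is a multiple of `p j`, whose curvature has already passed the
      -- test; hence an index strictly below `j` must fail.
      · have : (state H g ε M (i + 1)).y - (state H g ε M i).y =
            (inner ℝ (state H g ε M i).r (state H g ε M i).r /
              inner ℝ (state H g ε M i).p (damped H ε (state H g ε M i).p)) •
              (state H g ε M i).p := by
          simp only [state, next]; abel
        simp only [this, map_smul, real_inner_smul_left, real_inner_smul_right, norm_smul,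
          mul_pow, Real.norm_eq_abs, sq_abs, dampedMap_apply]
        have := (not_le.1 hp).le
        have h₂ := mul_le_mul_of_nonneg_left this
          (sq_nonneg (inner ℝ (state H g ε M i).r (state H g ε M i).r /
              inner ℝ (state H g ε M i).p (damped H ε (state H g ε M i).p)))
        nlinarith)
  rw [SlowRes, state_M hM] at hs
  have hsκ : 1 ≤ √κ := Real.one_le_sqrt.2 (by linarith)
  have hsκ2 : √κ ^ 2 = κ := Real.sq_sqrt (by linarith)
  have hτ : tau M ε = 1 / (√κ + 1) := rfl
  have hτ0 : 0 < tau M ε := by rw [hτ]; positivity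
  have hτ1 : tau M ε < 1 := by rw [hτ, div_lt_one (by positivity)]; linarith
  have hτκ : tau M ε ≤ 1 / √κ := by
    rw [hτ]; exact one_div_le_one_div_of_le (by positivity) (by linarith)
  have hq : 0 ≤ 1 - 1 / √κ := by
    rw [sub_nonneg, div_le_one (by positivity)]; exact hsκ
  have hs1 : √(1 - tau M ε) < 1 := by
    rw [Real.sqrt_lt' one_pos]; linarith
  -- The prefactor of `residual_decay` is below `T`, since `T ≥ 4 κ⁴` and `κ ≥ 2`. Together with `τ
  -- ≤ 1 / √κ` this contradicts the slow test.
  have hT : κ * √κ < bigT M ε := by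
    have h₁ : 0 < (1 - √(1 - tau M ε)) ^ 2 := by
      have : 0 < 1 - √(1 - tau M ε) := by linarith
      positivity
    have h₂ : (1 - √(1 - tau M ε)) ^ 2 ≤ 1 := by
      have := Real.sqrt_nonneg (1 - tau M ε)
      exact pow_le_one₀ (by linarith) (by linarith)
    rw [bigT, ← hκdef, lt_div_iff₀ h₁]
    have h₃ : √κ ≤ κ := by nlinarith
    have h₄ : (0 : ℝ) < κ ^ 2 := by positivity
    calc κ * √κ * (1 - √(1 - tau M ε)) ^ 2 ≤ κ * κ * 1 := by gcongr
      _ < 4 * κ ^ 4 := by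
          have : 4 ≤ κ ^ 2 := by nlinarith
          nlinarith
  have hT0 : 0 < bigT M ε := lt_of_le_of_lt (by positivity) hT
  have hpow : ((1 - tau M ε) ^ ((j : ℝ) / 2)) ^ 2 = (1 - tau M ε) ^ j := by
    rw [← Real.rpow_natCast ((1 - tau M ε) ^ ((j : ℝ) / 2)) 2, ← Real.rpow_mul (by linarith),
      ← Real.rpow_natCast]
    congr 1; push_cast; ring
  have hg0 : 0 < ‖g‖ := norm_pos_iff.2 hg
  have h₁ : bigT M ε * (1 - tau M ε) ^ j * ‖g‖ ^ 2 ≤ ‖(state H g ε M j).r‖ ^ 2 := by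
    have h := pow_le_pow_left₀ (mul_nonneg (mul_nonneg (Real.sqrt_nonneg _)
      (Real.rpow_nonneg (by linarith) _)) hg0.le) hs 2
    rwa [mul_pow, mul_pow, hpow, Real.sq_sqrt hT0.le] at h
  have h₂ : (1 - 1 / √κ) ^ j ≤ (1 - tau M ε) ^ j := pow_le_pow_left₀ hq (by linarith) j
  have h₃ : 0 < (1 - tau M ε) ^ j := pow_pos (by linarith) j
  have h₄ : κ * √κ * (1 - 1 / √κ) ^ j * ‖g‖ ^ 2 < bigT M ε * (1 - tau M ε) ^ j * ‖g‖ ^ 2 := by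
    have : κ * √κ * (1 - 1 / √κ) ^ j < bigT M ε * (1 - tau M ε) ^ j :=
      (mul_le_mul_of_nonneg_left h₂ (by positivity)).trans_lt (mul_lt_mul_of_pos_right hT h₃)
    exact mul_lt_mul_of_pos_right this (by positivity)
  linarith

/-- The procedure terminates and has something to return. -/
theorem exists_returns (hε : 0 < ε) (hM : ‖H‖ ≤ M) (hζ : 0 ≤ ζ) (hH : IsSelfAdjoint H)
    (hg : g ≠ 0) : ∃ t d, Returns H g ε ζ M t d := by
  classical
  by_cases h0 : inner ℝ (-g) (damped H ε (-g)) < ε * ‖-g‖ ^ 2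
  · exact ⟨_, _, .early h0⟩
  have hM0 : 0 ≤ M := (norm_nonneg H).trans hM
  have hex : ∃ j, 1 ≤ j ∧ Exit H g ε ζ M j := by
    by_contra! hcon
    -- A loop never left would produce more mutually orthogonal nonzero residuals than the dimension
    -- allows.
    exact (isCGSequence H g ε M).not_regular (dampedMap_isSymmetric hH)
      (regular_of_not_exit hε hM hζ hg h0 fun i hi _ => hcon i hi)
  obtain ⟨hj1, hjE⟩ := Nat.find_spec hex
  set j := Nat.find hex
  have hfirst : ∀ i, 1 ≤ i → i < j → ¬ Exit H g ε ζ M i := fun i hi hij hE =>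
    Nat.find_min hex hij ⟨hi, hE⟩
  have key : ∃ t d, ExitWith H g ε ζ M j t d := by
    by_cases h₁ : LowCurv H ε (state H g ε M j).y
    · exact ⟨_, _, .lowCurvY h₁⟩
    by_cases h₂ : SmallRes g ε ζ (state H g ε M j)
    · exact ⟨_, _, .solution h₁ h₂⟩
    by_cases h₃ : LowCurv H ε (state H g ε M j).p
    · exact ⟨_, _, .lowCurvP h₁ h₂ h₃⟩
    have h₄ : SlowRes g ε (state H g ε M j) j := by
      rcases hjE with h | h | h | h
      exacts [absurd h h₁, absurd h h₂, absurd h h₃, h]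
    have hreg : IsCGSequence.Regular (dampedMap H ε) (fun j => (state H g ε M j).r)
        (fun j => (state H g ε M j).p) (j + 1) := by
      intro i hi
      rcases Nat.lt_succ_iff_lt_or_eq.1 hi with hi | rfl
      · exact regular_of_not_exit hε hM hζ hg h0 hfirst i hi
      · exact ⟨r_ne_zero_of_not_smallRes hε hM0 hζ (state_M hM _) h₂,
          lt_of_le_of_lt (by positivity) (not_le.1 h₃)⟩
    obtain ⟨i, hi, hlow⟩ := exists_lowCurv_of_slowRes hε hM hH hg hreg h₃ h₄
    exact ⟨_, _, .slow h₁ h₂ h₃ h₄ i hi hlow⟩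
  obtain ⟨t, d, hd⟩ := key
  exact ⟨t, d, .loop h0 j hj1 hfirst t d hd⟩

/-- A direction of type `NC` is nonzero and has curvature at most `-ε`. -/
theorem Returns.negCurv {d : Vec n} (hε : 0 < ε) (hM : ‖H‖ ≤ M) (hζ : 0 ≤ ζ)
    (hH : IsSelfAdjoint H) (hg : g ≠ 0) (h : Returns H g ε ζ M DType.NC d) :
    d ≠ 0 ∧ inner ℝ d (H d) ≤ -ε * ‖d‖ ^ 2 := by
  have hM0 : 0 ≤ M := (norm_nonneg H).trans hM
  rw [← lowCurv_iff]
  cases h with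
  | early h => exact ⟨neg_ne_zero.2 hg, h.le⟩
  | loop h0 j hj hfirst _ _ hd =>
    have hreg := regular_of_not_exit hε hM hζ hg h0 hfirst
    cases hd with
    | lowCurvY h₁ =>
      refine ⟨?_, h₁⟩
      -- Used with `i = 0`, where `y 0 = 0`.
      have := y_sub_ne_zero hH hreg hj
      simpa [state, init] using this
    | lowCurvP h₁ h₂ h₃ =>
      exact ⟨p_ne_zero hH hreg (r_ne_zero_of_not_smallRes hε hM0 hζ (state_M hM _) h₂), h₃⟩
    | slow h₁ h₂ h₃ h₄ i hi h₅ =>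
      refine ⟨y_sub_ne_zero hH (j := j + 1) ?_ (by omega), h₅⟩
      intro i hi
      rcases Nat.lt_succ_iff_lt_or_eq.1 hi with hi | rfl
      · exact hreg i hi
      · exact ⟨r_ne_zero_of_not_smallRes hε hM0 hζ (state_M hM _) h₂,
          lt_of_le_of_lt (by positivity) (not_le.1 h₃)⟩

/-- A direction of type `SOL` is an approximate damped Newton step of good curvature. -/
theorem Returns.newtonStep {d : Vec n} (hε : 0 < ε) (hM : ‖H‖ ≤ M) (hζ : 0 ≤ ζ)
    (hH : IsSelfAdjoint H) (hg : g ≠ 0) (h : Returns H g ε ζ M DType.SOL d) :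
    -ε * ‖d‖ ^ 2 ≤ inner ℝ d (H d) ∧ inner ℝ d g = -inner ℝ d (damped H ε d) ∧
      ‖g + damped H ε d‖ ≤ zetaHat M ε ζ * ‖g‖ := by
  have hM0 : 0 ≤ M := (norm_nonneg H).trans hM
  cases h with
  | loop h0 j hj hfirst _ _ hd =>
    have hreg := regular_of_not_exit hε hM hζ hg h0 hfirst
    cases hd with
    | solution h₁ h₂ =>
      have hr : (state H g ε M j).r = g + damped H ε (state H g ε M j).y :=
        (isCGSequence H g ε M).r_eq j
      have ho := (isCGSequence H g ε M).inner_r_y_of_le (dampedMap_isSymmetric hH) hreg le_rfl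
      simp only [hr, inner_add_left] at ho
      refine ⟨(not_le.1 (lowCurv_iff.not.1 h₁)).le, ?_, ?_⟩
      · rw [real_inner_comm, real_inner_comm (damped H ε _)]
        linarith
      · rw [← hr]
        rwa [SmallRes, state_M hM] at h₂

end CappedCG

/-! ### Smallest eigenvalue and quadratic form -/

section EigenvalueBounds

variable {n : ℕ}

theorem abs_inner_apply_le (A : Mat n) (v : Vec n) : |inner ℝ v (A v)| ≤ ‖A‖ * ‖v‖ ^ 2 := by
  calc |inner ℝ v (A v)| ≤ ‖v‖ * ‖A v‖ := abs_real_inner_le_norm _ _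
    _ ≤ ‖v‖ * (‖A‖ * ‖v‖) := by gcongr; exact A.le_opNorm v
    _ = ‖A‖ * ‖v‖ ^ 2 := by ring

theorem le_of_hasEigenvalue {A : Mat n} {c μ : ℝ} (h : ∀ v, c * ‖v‖ ^ 2 ≤ inner ℝ v (A v))
    (hμ : Module.End.HasEigenvalue (A : Vec n →ₗ[ℝ] Vec n) μ) : c ≤ μ := by
  obtain ⟨v, hv⟩ := hμ.exists_hasEigenvector
  have h₁ : A v = μ • v := hv.apply_eq_smul
  have h₂ := h v
  have h₃ : 0 < ‖v‖ := norm_pos_iff.2 hv.2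
  rw [h₁, real_inner_smul_right, real_inner_self_eq_norm_sq] at h₂
  exact le_of_mul_le_mul_right h₂ (by positivity)

/-- The sign of `c` matters for `n = 0`: there are no eigenvalues and `sInf ∅ = 0`. -/
theorem neg_le_lambdaMin {A : Mat n} {c : ℝ} (hc : 0 ≤ c)
    (h : ∀ v, -c * ‖v‖ ^ 2 ≤ inner ℝ v (A v)) : -c ≤ lambdaMin A :=
  Real.le_sInf (fun _ hμ => le_of_hasEigenvalue h hμ) (by linarith)

/-- The infimum of the Rayleigh quotient is an eigenvalue. This links the oracle's failure
condition, stated with `lambdaMin`, to the quadratic form used elsewhere. -/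
theorem lambdaMin_lt {A : Mat n} (hA : IsSelfAdjoint A) {c : ℝ} {v : Vec n}
    (hv : inner ℝ v (A v) < c * ‖v‖ ^ 2) : lambdaMin A < c := by
  have hv0 : v ≠ 0 := by rintro rfl; simp at hv
  have hvn : 0 < ‖v‖ := norm_pos_iff.2 hv0
  have : Nontrivial (Vec n) := ⟨v, 0, hv0⟩
  have hlow : ∀ w, -‖A‖ * ‖w‖ ^ 2 ≤ inner ℝ w (A w) := fun w => by
    have := (abs_le.1 (abs_inner_apply_le A w)).1
    linarith
  have heig := hA.isSymmetric.hasEigenvalue_iInf_of_finiteDimensional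
  refine lt_of_le_of_lt (csInf_le ⟨-‖A‖, fun _ hμ => le_of_hasEigenvalue hlow hμ⟩ heig) ?_
  refine lt_of_le_of_lt (ciInf_le ⟨-‖A‖, ?_⟩ (⟨v, hv0⟩ : {x : Vec n // x ≠ 0})) ?_
  · rintro _ ⟨⟨w, hw⟩, rfl⟩
    have hwn : 0 < ‖w‖ := norm_pos_iff.2 hw
    change -‖A‖ ≤ inner ℝ (A w) w / ‖w‖ ^ 2
    rw [le_div_iff₀ (by positivity), real_inner_comm]
    exact hlow w
  · change inner ℝ (A v) v / ‖v‖ ^ 2 < c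
    rwa [div_lt_iff₀ (by positivity), real_inner_comm]

end EigenvalueBounds

/-! ### Taylor estimates along a segment -/

section Taylor

theorem le_of_hasDerivAt_nonneg {u u' : ℝ → ℝ} (hu : ∀ t, HasDerivAt u (u' t) t)
    (hu' : ∀ t ∈ Set.Icc (0 : ℝ) 1, 0 ≤ u' t) {t : ℝ} (ht : t ∈ Set.Icc (0 : ℝ) 1) :
    u 0 ≤ u t := by
  refine monotoneOn_of_deriv_nonneg (convex_Icc 0 1)
    (fun s _ => (hu s).continuousAt.continuousWithinAt)
    (fun s _ => (hu s).differentiableAt.differentiableWithinAt) (fun s hs => ?_)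
    (Set.left_mem_Icc.2 zero_le_one) ht ht.1
  rw [(hu s).deriv]
  exact hu' s (interior_subset hs)

variable {n : ℕ} {f : Vec n → ℝ}

theorem hasFDerivAt_gradient (hf : ContDiff ℝ 2 f) (x : Vec n) :
    HasFDerivAt (gradient f) (hessian f x) x := by
  have h₁ : ContDiff ℝ 1 (fderiv ℝ f) := hf.fderiv_right (by norm_num)
  have h₂ : ContDiff ℝ 1 (gradient f) :=
    (InnerProductSpace.toDual ℝ (Vec n)).symm.contDiff.comp h₁
  exact ((h₂.differentiable one_ne_zero) x).hasFDerivAt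

theorem add_smul_mem_segment {x d : Vec n} {t : ℝ} (ht : t ∈ Set.Icc (0 : ℝ) 1) :
    x + t • d ∈ segment ℝ x (x + d) := by
  rw [segment_eq_image']
  exact ⟨t, ht, by simp⟩

/-- Second order Taylor bound with a Lipschitz continuous Hessian. -/
theorem taylor_upper_bound (hf : ContDiff ℝ 2 f) {B : Set (Vec n)} {LH : ℝ}
    (hL : ∀ x ∈ B, ∀ y ∈ B, ‖hessian f x - hessian f y‖ ≤ LH * ‖x - y‖) {x d : Vec n}
    (hB : segment ℝ x (x + d) ⊆ B) {t : ℝ} (ht : t ∈ Set.Icc (0 : ℝ) 1) :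
    f (x + t • d) ≤ f x + t * inner ℝ (gradient f x) d + t ^ 2 / 2 * inner ℝ d (hessian f x d)
      + LH / 6 * t ^ 3 * ‖d‖ ^ 3 := by
  set a := inner ℝ (gradient f x) d
  set b := inner ℝ d (hessian f x d)
  have hline : ∀ t : ℝ, HasDerivAt (fun t : ℝ => x + t • d) d t := fun t => by
    simpa using ((hasDerivAt_id t).smul_const d).const_add x
  have hf1 : ∀ t : ℝ, HasDerivAt (fun t : ℝ => f (x + t • d))
      (inner ℝ (gradient f (x + t • d)) d) t := fun t => by
    have h₁ := ((hf.differentiable two_ne_zero) (x + t • d)).hasFDerivAt.comp_hasDerivAt t (hline t)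
    rwa [inner_gradient_left]
  have hf2 : ∀ t : ℝ, HasDerivAt (fun t : ℝ => (inner ℝ (gradient f (x + t • d)) d : ℝ))
      (inner ℝ (hessian f (x + t • d) d) d) t := fun t => by
    have h₁ := (hasFDerivAt_gradient hf (x + t • d)).comp_hasDerivAt t (hline t)
    simpa using h₁.inner ℝ (hasDerivAt_const t d)
  have hbound : ∀ t ∈ Set.Icc (0 : ℝ) 1,
      inner ℝ (hessian f (x + t • d) d) d ≤ b + LH * t * ‖d‖ ^ 3 := by
    intro t ht
    have hxB : x ∈ B := hB (left_mem_segment ℝ _ _)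
    have h₁ := hL _ (hB (add_smul_mem_segment ht)) _ hxB
    have h₂ := (abs_le.1 (abs_inner_apply_le (hessian f (x + t • d) - hessian f x) d)).2
    rw [add_sub_cancel_left, norm_smul, Real.norm_of_nonneg ht.1] at h₁
    rw [sub_apply, inner_sub_right] at h₂
    rw [real_inner_comm]
    have h₃ := mul_le_mul_of_nonneg_right h₁ (sq_nonneg ‖d‖)
    nlinarith
  -- Integration is replaced by monotonicity: bound minus function vanishes at `0` and has
  -- nonnegative derivative. The same device is then applied to `f`.
  have hgrad : ∀ t ∈ Set.Icc (0 : ℝ) 1,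
      inner ℝ (gradient f (x + t • d)) d ≤ a + t * b + LH / 2 * t ^ 2 * ‖d‖ ^ 3 := by
    intro t ht
    have h₁ : ∀ t : ℝ, HasDerivAt (fun t : ℝ => a + t * b + LH / 2 * t ^ 2 * ‖d‖ ^ 3
        - inner ℝ (gradient f (x + t • d)) d)
        (b + LH * t * ‖d‖ ^ 3 - inner ℝ (hessian f (x + t • d) d) d) t := fun t => by
      have h := ((((hasDerivAt_id t).mul_const b).const_add a).add
        ((((hasDerivAt_id t).pow 2).const_mul (LH / 2)).mul_const (‖d‖ ^ 3))).sub (hf2 t)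
      refine h.congr_deriv ?_
      simp only [id, Nat.cast_ofNat, Nat.add_one_sub_one, pow_one]; ring
    have h₂ := le_of_hasDerivAt_nonneg h₁ (fun s hs => by linarith [hbound s hs]) ht
    simp only [zero_smul, add_zero, zero_mul, ne_eq, OfNat.ofNat_ne_zero, not_false_eq_true,
      zero_pow, mul_zero] at h₂
    change a - a ≤ _ at h₂
    linarith
  have h₁ : ∀ t : ℝ, HasDerivAt (fun t : ℝ => f x + t * a + t ^ 2 / 2 * b
      + LH / 6 * t ^ 3 * ‖d‖ ^ 3 - f (x + t • d))
      (a + t * b + LH / 2 * t ^ 2 * ‖d‖ ^ 3 - inner ℝ (gradient f (x + t • d)) d) t := fun t => by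
    have h := (((((hasDerivAt_id t).mul_const a).const_add (f x)).add
      ((((hasDerivAt_id t).pow 2).div_const 2).mul_const b)).add
      ((((hasDerivAt_id t).pow 3).const_mul (LH / 6)).mul_const (‖d‖ ^ 3))).sub (hf1 t)
    refine h.congr_deriv ?_
    simp only [id, Nat.cast_ofNat, Nat.add_one_sub_one, pow_one]; ring
  have h₂ := le_of_hasDerivAt_nonneg h₁ (fun s hs => by linarith [hgrad s hs]) ht
  simp only [zero_smul, add_zero, zero_mul, ne_eq, OfNat.ofNat_ne_zero, not_false_eq_true,
    zero_pow, mul_zero, zero_div, sub_self] at h₂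
  linarith

theorem norm_gradient_sub_le (hf : ContDiff ℝ 2 f) {B : Set (Vec n)} {LH : ℝ} (hLH : 0 ≤ LH)
    (hL : ∀ x ∈ B, ∀ y ∈ B, ‖hessian f x - hessian f y‖ ≤ LH * ‖x - y‖) {x d : Vec n}
    (hB : segment ℝ x (x + d) ⊆ B) :
    ‖gradient f (x + d) - gradient f x - hessian f x d‖ ≤ LH * ‖d‖ ^ 2 := by
  have hxB : x ∈ B := hB (left_mem_segment ℝ _ _)
  have h := (convex_segment x (x + d)).norm_image_sub_le_of_norm_hasFDerivWithin_le'
    (f := gradient f) (φ := hessian f x) (C := LH * ‖d‖)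
    (fun y _ => (hasFDerivAt_gradient hf y).hasFDerivWithinAt) (fun y hy => by
      refine (hL y (hB hy) x hxB).trans ?_
      gcongr
      rw [segment_eq_image'] at hy
      obtain ⟨t, ht, rfl⟩ := hy
      simp only [add_sub_cancel_left, norm_smul, Real.norm_of_nonneg ht.1]
      exact mul_le_of_le_one_left (norm_nonneg d) ht.2)
    (left_mem_segment ℝ _ _) (right_mem_segment ℝ _ _)
  rw [add_sub_cancel_left] at h
  linarith [h]

end Taylor

/-! ### Line search: rejected steps are not small -/

namespace NewtonCG

section LineSearch

variable {n : ℕ} {f : Vec n → ℝ} {prm : Params} {x d : Vec n}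

theorem lineSearch_eq_some {t : DType} (h : ∃ j, Accept f prm.η x d (trialStep prm.θ t j)) :
    ∃ j, lineSearch f prm x t d = some (trialStep prm.θ t j) ∧
      Accept f prm.η x d (trialStep prm.θ t j) ∧
      ∀ i < j, ¬ Accept f prm.η x d (trialStep prm.θ t i) := by
  classical
  refine ⟨Nat.find h, ?_, Nat.find_spec h, fun i hi => Nat.find_min h hi⟩
  rw [lineSearch, dif_pos h]

theorem trialStep_NC_two_mul (θ : ℝ) (i : ℕ) : trialStep θ DType.NC (2 * i) = θ ^ i := by
  simp [trialStep]

theorem trialStep_NC_two_mul_add_one (θ : ℝ) (i : ℕ) :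
    trialStep θ DType.NC (2 * i + 1) = -θ ^ i := by
  have : (2 * i + 1) / 2 = i := by omega
  simp [trialStep, this]

theorem abs_trialStep_NC {θ : ℝ} (hθ : 0 ≤ θ) (j : ℕ) :
    |trialStep θ DType.NC j| = θ ^ (j / 2) := by
  simp only [trialStep]
  split_ifs
  · exact abs_of_nonneg (by positivity)
  · rw [abs_neg]; exact abs_of_nonneg (by positivity)

/-- A bidirectional search ends if short steps are accepted in one of the two directions, and the
accepted step is at most a factor `θ` shorter than necessary. -/
theorem lineSearch_NC {T : ℝ} (hT : 0 < T)
    (hrej : ∀ i, ¬ Accept f prm.η x d (prm.θ ^ i) → ¬ Accept f prm.η x d (-prm.θ ^ i) →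
      T ≤ prm.θ ^ i) :
    ∃ α, lineSearch f prm x DType.NC d = some α ∧ Accept f prm.η x d α ∧
      min (prm.θ * T) 1 ≤ |α| := by
  obtain ⟨i, hi⟩ := exists_pow_lt_of_lt_one hT prm.θ_lt_one
  have hex : ∃ j, Accept f prm.η x d (trialStep prm.θ DType.NC j) := by
    by_contra! hcon
    have h₁ := hcon (2 * i)
    have h₂ := hcon (2 * i + 1)
    rw [trialStep_NC_two_mul] at h₁
    rw [trialStep_NC_two_mul_add_one] at h₂
    exact absurd (hrej i h₁ h₂) (not_le.2 hi)
  obtain ⟨j, hj, hacc, hmin⟩ := lineSearch_eq_some hex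
  refine ⟨_, hj, hacc, ?_⟩
  rw [abs_trialStep_NC prm.θ_pos.le]
  rcases hj2 : j / 2 with _ | l
  · simp
  -- Since `j / 2 = l + 1`, both signs of the preceding power `θ ^ l` were tried before `j` and
  -- rejected.
  · have h₁ := hmin (2 * l) (by omega)
    have h₂ := hmin (2 * l + 1) (by omega)
    rw [trialStep_NC_two_mul] at h₁
    rw [trialStep_NC_two_mul_add_one] at h₂
    refine (min_le_left _ _).trans ?_
    rw [pow_succ']
    exact mul_le_mul_of_nonneg_left (hrej l h₁ h₂) prm.θ_pos.le

theorem lineSearch_SOL {T : ℝ} (hT : 0 < T)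
    (hrej : ∀ i, ¬ Accept f prm.η x d (prm.θ ^ i) → T ≤ prm.θ ^ i) :
    ∃ α, lineSearch f prm x DType.SOL d = some α ∧ Accept f prm.η x d α ∧
      (α = 1 ∨ prm.θ * T ≤ α) := by
  obtain ⟨i, hi⟩ := exists_pow_lt_of_lt_one hT prm.θ_lt_one
  have hex : ∃ j, Accept f prm.η x d (trialStep prm.θ DType.SOL j) := by
    by_contra! hcon
    exact absurd (hrej i (hcon i)) (not_le.2 hi)
  obtain ⟨j, hj, hacc, hmin⟩ := lineSearch_eq_some hex
  refine ⟨_, hj, hacc, ?_⟩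
  simp only [trialStep] at hmin ⊢
  rcases j with _ | l
  · simp
  · right
    rw [pow_succ']
    exact mul_le_mul_of_nonneg_left (hrej l (hmin l (by omega))) prm.θ_pos.le

variable {B : Set (Vec n)} {LH : ℝ} {H : Mat n}

/-- Along a direction of negative curvature, if the steps `t` and `-t` are both rejected, then `t`
is not small. -/
theorem le_of_reject_NC (hf : ContDiff ℝ 2 f)
    (hL : ∀ x ∈ B, ∀ y ∈ B, ‖hessian f x - hessian f y‖ ≤ LH * ‖x - y‖) (hLH : 0 < LH)
    (hB : segment ℝ x (x + d) ⊆ B) (hB' : segment ℝ x (x + -d) ⊆ B) (hd : 0 < ‖d‖)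
    (hcurv : inner ℝ d (H d) = -‖d‖ ^ 3) (hH : ‖H - hessian f x‖ ≤ ‖d‖ / 2)
    {t : ℝ} (ht0 : 0 < t) (ht1 : t ≤ 1) (h₁ : ¬ Accept f prm.η x d t)
    (h₂ : ¬ Accept f prm.η x d (-t)) : 3 / (2 * (LH + prm.η)) ≤ t := by
  have ht : t ∈ Set.Icc (0 : ℝ) 1 := ⟨ht0.le, ht1⟩
  have hη := prm.η_pos
  have hcurv' : inner ℝ d (hessian f x d) ≤ -(‖d‖ ^ 3 / 2) := by
    have h := (abs_le.1 (abs_inner_apply_le (H - hessian f x) d)).1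
    rw [sub_apply, inner_sub_right, hcurv] at h
    have := mul_le_mul_of_nonneg_right hH (sq_nonneg ‖d‖)
    nlinarith
  have u₁ := taylor_upper_bound hf hL hB ht
  have u₂ := taylor_upper_bound hf hL hB' ht
  simp only [Accept, not_lt, abs_neg, abs_of_pos ht0] at h₁ h₂
  simp only [smul_neg, inner_neg_right, inner_neg_left, map_neg, norm_neg, neg_neg] at u₂
  rw [neg_smul] at h₂
  have h₃ : t ^ 2 / 2 * inner ℝ d (hessian f x d) ≤ t ^ 2 / 2 * -(‖d‖ ^ 3 / 2) := by gcongr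
  -- Sum of the two rejections and the two Taylor bounds; the slopes cancel.
  have h₄ : t ^ 2 * ‖d‖ ^ 3 * (3 / 2) ≤ t ^ 2 * ‖d‖ ^ 3 * ((LH + prm.η) * t) := by nlinarith
  have h₅ : 3 / 2 ≤ (LH + prm.η) * t := le_of_mul_le_mul_left h₄ (by positivity)
  rw [div_le_iff₀ (by positivity)]
  linarith

/-- Along an approximate damped Newton step, a rejected step is not small. -/
theorem le_of_reject_SOL (hf : ContDiff ℝ 2 f)
    (hL : ∀ x ∈ B, ∀ y ∈ B, ‖hessian f x - hessian f y‖ ≤ LH * ‖x - y‖)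
    (hB : segment ℝ x (x + d) ⊆ B) (hd : 0 < ‖d‖) {g : Vec n} {e : ℝ} (he : 0 < e)
    (hcurv : -e * ‖d‖ ^ 2 ≤ inner ℝ d (H d))
    (hgd : inner ℝ d g = -(inner ℝ d (H d) + 2 * e * ‖d‖ ^ 2))
    (hg : ‖g - gradient f x‖ ≤ e * ‖d‖ / 8) (hH : ‖H - hessian f x‖ ≤ e / 4)
    {t : ℝ} (ht0 : 0 < t) (ht1 : t ≤ 1) (h₁ : ¬ Accept f prm.η x d t) :
    3 / 4 * e ≤ (LH + prm.η) * t ^ 2 * ‖d‖ := by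
  have ht : t ∈ Set.Icc (0 : ℝ) 1 := ⟨ht0.le, ht1⟩
  have u := taylor_upper_bound hf hL hB ht
  simp only [Accept, not_lt, abs_of_pos ht0] at h₁
  have hcurv' : inner ℝ d (hessian f x d) ≤ inner ℝ d (H d) + e / 4 * ‖d‖ ^ 2 := by
    have h := (abs_le.1 (abs_inner_apply_le (H - hessian f x) d)).1
    rw [sub_apply, inner_sub_right] at h
    have := mul_le_mul_of_nonneg_right hH (sq_nonneg ‖d‖)
    linarith
  have hslope : inner ℝ (gradient f x) d ≤
      -(inner ℝ d (H d) + 2 * e * ‖d‖ ^ 2) + e * ‖d‖ ^ 2 / 8 := by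
    have h := (abs_le.1 (abs_real_inner_le_norm (g - gradient f x) d)).1
    have h' := mul_le_mul_of_nonneg_right hg hd.le
    rw [inner_sub_left, real_inner_comm d g, hgd] at h
    nlinarith
  set c := inner ℝ d (H d)
  set D := ‖d‖ ^ 2 with hD
  have hD0 : 0 < D := by positivity
  have e₁ : t * inner ℝ (gradient f x) d ≤ t * (-(c + 2 * e * D) + e * D / 8) := by gcongr
  have e₂ : t ^ 2 / 2 * inner ℝ d (hessian f x d) ≤ t ^ 2 / 2 * (c + e / 4 * D) := by gcongr
  -- Since `c + e * D ≥ 0` and `t ≤ 2`, the part of the curvature beyond `-e * D` only helps; what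
  -- is left is at most `-(7/8) * e * D`.
  have e₃ : t * (-(c + 2 * e * D) + e * D / 8) + t ^ 2 / 2 * (c + e / 4 * D) ≤
      t * -(3 / 4 * e * D) := by
    have q : 0 ≤ (c + e * D) * (1 - t / 2) := mul_nonneg (by linarith) (by linarith)
    have q2 : 0 ≤ e * D * t := by positivity
    have q3 : 0 ≤ e * D * (1 - t) := mul_nonneg (by positivity) (by linarith)
    have : -(c + 2 * e * D) + e * D / 8 + t / 2 * (c + e / 4 * D) ≤ -(3 / 4 * e * D) := by
      nlinarith
    nlinarith [mul_le_mul_of_nonneg_left this ht0.le]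
  have e₄ : (t * D) * (3 / 4 * e) ≤ (t * D) * ((LH + prm.η) / 6 * t ^ 2 * ‖d‖) := by
    have : ‖d‖ ^ 3 = D * ‖d‖ := by rw [hD]; ring
    rw [this] at u h₁
    nlinarith
  have e₅ := le_of_mul_le_mul_left e₄ (by positivity)
  -- The factor `1/6` is given away to match the constant in `cSol`.
  nlinarith

end LineSearch

end NewtonCG

/-! ### Decrease and stationarity in one iteration -/

namespace NewtonCG

theorem sq_rpow_three_halves {a : ℝ} (ha : 0 ≤ a) : (a ^ 2) ^ (3 / 2 : ℝ) = a ^ 3 := by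
  rw [← Real.rpow_natCast a 2, ← Real.rpow_mul ha, ← Real.rpow_natCast a 3]
  norm_num

/-- The factor of `ε^{3/2}` in the guaranteed decrease per iteration. -/
noncomputable def decreaseCoeff (prm : Params) (LH : ℝ) : ℝ :=
  min (1 / (64 * LH ^ (3 / 2 : ℝ)) * cSol prm LH)
    (min (8 * LH ^ (3 / 2 : ℝ) * cSol prm LH) (LH ^ (3 / 2 : ℝ) * cNC prm LH / 8))

theorem Params.ζ_lt_one (prm : Params) : prm.ζ < 1 := prm.ζ_lt.trans_le (min_le_left _ _)

section Constants

variable {prm : Params} {LH : ℝ}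

theorem cSol_pos (hLH : 0 < LH) : 0 < cSol prm LH := by
  have h₁ := prm.η_pos
  have h₂ := prm.θ_pos
  have h₃ : 0 < 1 - prm.ζ := sub_pos.2 prm.ζ_lt_one
  rw [cSol]
  exact mul_pos (by positivity) (lt_min (by positivity) (by positivity))

theorem cNC_pos (hLH : 0 < LH) : 0 < cNC prm LH := by
  have h₁ := prm.η_pos
  have h₂ := prm.θ_pos
  rw [cNC]
  exact mul_pos (by positivity) (lt_min (by positivity) one_pos)

theorem decreaseCoeff_pos (hLH : 0 < LH) : 0 < decreaseCoeff prm LH := by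
  have h₁ := cSol_pos (prm := prm) hLH
  have h₂ := cNC_pos (prm := prm) hLH
  rw [decreaseCoeff]
  exact lt_min (by positivity) (lt_min (by positivity) (by positivity))

/-- The multipliers `1 / (64 LH^(3/2))` and `8 LH^(3/2)` of `cSol` have product `1/8`, so one of
them is at most `1`. -/
theorem decreaseCoeff_le_cSol (hLH : 0 < LH) : decreaseCoeff prm LH ≤ cSol prm LH := by
  have hc := cSol_pos (prm := prm) hLH
  have hl : 0 < LH ^ (3 / 2 : ℝ) := by positivity
  rcases le_total (LH ^ (3 / 2 : ℝ)) (1 / 8) with h | h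
  · refine ((min_le_right _ _).trans (min_le_left _ _)).trans ?_
    nlinarith
  · refine (min_le_left _ _).trans ?_
    have : 1 / (64 * LH ^ (3 / 2 : ℝ)) ≤ 1 := by
      rw [div_le_one (by positivity)]; linarith
    nlinarith

/-- For unit Newton steps, where `‖d‖³ ≥ (ε / LH)^(3/2)` is the only available bound. -/
theorem decreaseCoeff_le_div (hLH : 0 < LH) :
    decreaseCoeff prm LH ≤ prm.η / 6 / LH ^ (3 / 2 : ℝ) := by
  have hη := prm.η_pos
  have hl : 0 < LH ^ (3 / 2 : ℝ) := by positivity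
  have hc : cSol prm LH ≤ prm.η / 6 := by
    rw [cSol]
    refine mul_le_of_le_one_right (by positivity) ((min_le_left _ _).trans ?_)
    rw [div_le_one (by positivity)]
    exact Real.one_le_rpow (by linarith) (by norm_num)
  refine (min_le_left _ _).trans ?_
  calc 1 / (64 * LH ^ (3 / 2 : ℝ)) * cSol prm LH
      ≤ 1 / (64 * LH ^ (3 / 2 : ℝ)) * (prm.η / 6) := by gcongr
    _ = prm.η / 6 / LH ^ (3 / 2 : ℝ) / 64 := by field_simp
    _ ≤ prm.η / 6 / LH ^ (3 / 2 : ℝ) := div_le_self (by positivity) (by norm_num)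

end Constants

variable {n : ℕ} {f : Vec n → ℝ} {prm : Params} {x₀ : Vec n} {flow : ℝ} {B : Set (Vec n)}
  {Lg LH ε : ℝ}

/-- Sufficient decrease along a direction of negative curvature. -/
theorem decrease_NC (hs : SmoothOn f x₀ flow B Lg LH) (hε : 0 < ε) (hεH : prm.εH = √(LH * ε))
    {x d : Vec n} {H : Mat n} (hB : segment ℝ x (x + d) ⊆ B) (hB' : segment ℝ x (x + -d) ⊆ B)
    (hd : prm.εH / 2 ≤ ‖d‖) (hcurv : inner ℝ d (H d) = -‖d‖ ^ 3)
    (hH : ‖H - hessian f x‖ ≤ (1 - prm.ζ) / 4 * prm.εH) :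
    ∃ α, lineSearch f prm x DType.NC d = some α ∧
      f (x + α • d) + decreaseCoeff prm LH * ε ^ (3 / 2 : ℝ) ≤ f x := by
  have hLH := hs.LH_pos
  have hη := prm.η_pos
  have hθ := prm.θ_pos
  have hεH0 := prm.εH_pos
  have hd0 : 0 < ‖d‖ := by linarith
  have hH' : ‖H - hessian f x‖ ≤ ‖d‖ / 2 := by nlinarith [prm.ζ_pos]
  obtain ⟨α, hα, hacc, hmin⟩ := lineSearch_NC (f := f) (prm := prm) (x := x) (d := d)
    (T := 3 / (2 * (LH + prm.η))) (by positivity) fun i h₁ h₂ =>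
      le_of_reject_NC hs.smooth hs.lipHess hLH hB hB' hd0 hcurv hH' (by positivity)
        (pow_le_one₀ hθ.le prm.θ_lt_one.le) h₁ h₂
  refine ⟨α, hα, ?_⟩
  rw [Accept] at hacc
  set b := 3 * prm.θ / (2 * (LH + prm.η)) with hb
  have hb0 : 0 < b := by positivity
  have hb' : prm.θ * (3 / (2 * (LH + prm.η))) = b := by rw [hb]; ring
  rw [hb'] at hmin
  have h₁ : min (b ^ 3) 1 ≤ |α| ^ 3 := by
    rcases le_total b 1 with h | h
    · rw [min_eq_left h] at hmin
      exact (min_le_left _ _).trans (pow_le_pow_left₀ hb0.le hmin 3)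
    · rw [min_eq_right h] at hmin
      exact (min_le_right _ _).trans (one_le_pow₀ hmin)
  -- The oracle guarantees only half of `εH`; the cube of this half is the `1/8` next to `cNC`.
  have h₂ : (prm.εH / 2) ^ 3 ≤ ‖d‖ ^ 3 := pow_le_pow_left₀ (by positivity) hd 3
  have h₃ : prm.εH ^ 3 = LH ^ (3 / 2 : ℝ) * ε ^ (3 / 2 : ℝ) := by
    rw [← sq_rpow_three_halves hεH0.le, hεH, Real.sq_sqrt (by positivity),
      Real.mul_rpow hLH.le hε.le]
  have h₄ : decreaseCoeff prm LH * ε ^ (3 / 2 : ℝ) ≤ prm.η / 6 * |α| ^ 3 * ‖d‖ ^ 3 := by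
    calc decreaseCoeff prm LH * ε ^ (3 / 2 : ℝ)
        ≤ LH ^ (3 / 2 : ℝ) * cNC prm LH / 8 * ε ^ (3 / 2 : ℝ) := by
          gcongr
          exact (min_le_right _ _).trans (min_le_right _ _)
      _ = prm.η / 6 * min (b ^ 3) 1 * (prm.εH / 2) ^ 3 := by
          rw [div_pow prm.εH 2 3, h₃, cNC]; ring
      _ ≤ prm.η / 6 * |α| ^ 3 * ‖d‖ ^ 3 := by gcongr
  linarith

/-- Sufficient decrease along an approximate damped Newton step. -/
theorem decrease_SOL (hs : SmoothOn f x₀ flow B Lg LH) (hε : 0 < ε) (hεH : prm.εH = √(LH * ε))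
    {x d g : Vec n} {H : Mat n} (hB : segment ℝ x (x + d) ⊆ B)
    (hd : ε < prm.εH * ‖d‖) (hcurv : -prm.εH * ‖d‖ ^ 2 ≤ inner ℝ d (H d))
    (hgd : inner ℝ d g = -(inner ℝ d (H d) + 2 * prm.εH * ‖d‖ ^ 2))
    (hg : ‖g - gradient f x‖ ≤ (1 - prm.ζ) / 8 * (prm.εH * ‖d‖))
    (hH : ‖H - hessian f x‖ ≤ (1 - prm.ζ) / 4 * prm.εH) :
    ∃ α, lineSearch f prm x DType.SOL d = some α ∧
      f (x + α • d) + decreaseCoeff prm LH * ε ^ (3 / 2 : ℝ) ≤ f x := by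
  have hLH := hs.LH_pos
  have hη := prm.η_pos
  have hθ := prm.θ_pos
  have hζ := prm.ζ_pos
  have hζ1 := prm.ζ_lt_one
  have hεH0 := prm.εH_pos
  have hd0 : 0 < ‖d‖ := pos_of_mul_pos_right (hε.trans hd) hεH0.le
  have hεd : 0 < prm.εH * ‖d‖ := by positivity
  have hεsq : prm.εH ^ 2 = LH * ε := by rw [hεH, Real.sq_sqrt (by positivity)]
  set T := √(3 / 4 * prm.εH / ((LH + prm.η) * ‖d‖)) with hT
  have hT0 : 0 < T := by rw [hT]; positivity
  have hT2 : T ^ 2 = 3 / 4 * prm.εH / ((LH + prm.η) * ‖d‖) := Real.sq_sqrt (by positivity)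
  obtain ⟨α, hα, hacc, hmin⟩ := lineSearch_SOL (f := f) (prm := prm) (x := x) (d := d) hT0
    fun i h₁ => by
      have h := le_of_reject_SOL hs.smooth hs.lipHess hB hd0 hεH0 hcurv hgd
        (by nlinarith) (by nlinarith) (by positivity)
        (pow_le_one₀ hθ.le prm.θ_lt_one.le) h₁
      rw [hT]
      refine Real.sqrt_le_iff.2 ⟨by positivity, ?_⟩
      rw [div_le_iff₀ (by positivity)]
      linarith
  refine ⟨α, hα, ?_⟩
  rw [Accept] at hacc
  have key : decreaseCoeff prm LH * ε ^ (3 / 2 : ℝ) ≤ prm.η / 6 * |α| ^ 3 * ‖d‖ ^ 3 := by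
    rcases hmin with rfl | hmin
    · have h₁ : ε / LH ≤ ‖d‖ ^ 2 := by
        rw [div_le_iff₀ hLH]
        have : ε ^ 2 ≤ (prm.εH * ‖d‖) ^ 2 := pow_le_pow_left₀ hε.le hd.le 2
        rw [mul_pow, hεsq] at this
        nlinarith
      have h₂ : (ε / LH) ^ (3 / 2 : ℝ) ≤ ‖d‖ ^ 3 := by
        rw [← sq_rpow_three_halves hd0.le]
        exact Real.rpow_le_rpow (by positivity) h₁ (by norm_num)
      rw [Real.div_rpow hε.le hLH.le] at h₂
      calc decreaseCoeff prm LH * ε ^ (3 / 2 : ℝ)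
          ≤ prm.η / 6 / LH ^ (3 / 2 : ℝ) * ε ^ (3 / 2 : ℝ) := by
            gcongr; exact decreaseCoeff_le_div hLH
        _ = prm.η / 6 * (ε ^ (3 / 2 : ℝ) / LH ^ (3 / 2 : ℝ)) := by ring
        _ ≤ prm.η / 6 * ‖d‖ ^ 3 := by gcongr
        _ = _ := by simp
    · have hα0 : 0 < α := lt_of_lt_of_le (by positivity) hmin
      set a := 3 * prm.θ ^ 2 * (1 - prm.ζ) / (4 * (LH + prm.η)) with ha
      have ha0 : 0 ≤ a := by
        have : 0 < 1 - prm.ζ := by linarith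
        positivity
      -- In `(θ T)² ‖d‖²` one factor `‖d‖` cancels and the other combines with `εH` to a product
      -- above `ε`.
      have h₁ : a * ε ≤ (α * ‖d‖) ^ 2 := by
        calc a * ε ≤ 3 * prm.θ ^ 2 * 1 / (4 * (LH + prm.η)) * (prm.εH * ‖d‖) := by
              rw [ha]; gcongr; linarith
          _ = (prm.θ * T) ^ 2 * ‖d‖ ^ 2 := by rw [mul_pow, hT2]; field_simp
          _ ≤ α ^ 2 * ‖d‖ ^ 2 := by gcongr
          _ = (α * ‖d‖) ^ 2 := by ring
      have h₂ : (a * ε) ^ (3 / 2 : ℝ) ≤ (α * ‖d‖) ^ 3 := by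
        rw [← sq_rpow_three_halves (by positivity)]
        exact Real.rpow_le_rpow (by positivity) h₁ (by norm_num)
      rw [Real.mul_rpow ha0 hε.le] at h₂
      calc decreaseCoeff prm LH * ε ^ (3 / 2 : ℝ)
          ≤ cSol prm LH * ε ^ (3 / 2 : ℝ) := by gcongr; exact decreaseCoeff_le_cSol hLH
        _ ≤ prm.η / 6 * a ^ (3 / 2 : ℝ) * ε ^ (3 / 2 : ℝ) := by
            rw [cSol]; gcongr; exact min_le_right _ _
        _ = prm.η / 6 * (a ^ (3 / 2 : ℝ) * ε ^ (3 / 2 : ℝ)) := by ring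
        _ ≤ prm.η / 6 * (α * ‖d‖) ^ 3 := by gcongr
        _ = _ := by rw [abs_of_pos hα0]; ring
  linarith

theorem sgn_mul_self (t : ℝ) : sgn t * sgn t = 1 := by
  rw [sgn]; split_ifs <;> norm_num

theorem abs_sgn (t : ℝ) : |sgn t| = 1 := by
  rw [sgn]; split_ifs <;> norm_num

/-- The scaling makes the length equal to the absolute curvature of the unit vector; the sign enters
the quadratic form squared. -/
theorem meoDirection_spec (g : Vec n) {H : Mat n} {e : ℝ} (he : 0 < e) {v : Vec n}
    (hv : ‖v‖ = 1) (hcurv : inner ℝ v (H v) ≤ -e / 2) :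
    e / 2 ≤ ‖meoDirection g H v‖ ∧
      inner ℝ (meoDirection g H v) (H (meoDirection g H v)) = -‖meoDirection g H v‖ ^ 3 := by
  set c := inner ℝ v (H v)
  have hc : |c| = -c := abs_of_nonpos (by linarith)
  have hn : ‖meoDirection g H v‖ = -c := by
    rw [meoDirection, norm_smul, hv, norm_neg, norm_mul, Real.norm_eq_abs, Real.norm_eq_abs,
      abs_sgn, abs_abs, one_mul, mul_one, hc]
  refine ⟨by rw [hn]; linarith, ?_⟩
  rw [hn, meoDirection, map_smul, real_inner_smul_left, real_inner_smul_right]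
  change -(sgn _ * |c|) * (-(sgn _ * |c|) * c) = _
  linear_combination (|c| ^ 2 * c) * sgn_mul_self (inner ℝ v g) + c * sq_abs c

theorem ncDirection_spec (g : Vec n) {H : Mat n} {e : ℝ} (he : 0 < e) {d : Vec n}
    (hd : d ≠ 0) (hcurv : inner ℝ d (H d) ≤ -e * ‖d‖ ^ 2) :
    e ≤ ‖ncDirection g H d‖ ∧
      inner ℝ (ncDirection g H d) (H (ncDirection g H d)) = -‖ncDirection g H d‖ ^ 3 := by
  have hd0 : 0 < ‖d‖ := norm_pos_iff.2 hd
  set c := inner ℝ d (H d) with hcdef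
  have hc : |c| = -c := abs_of_nonpos (hcurv.trans (by nlinarith [sq_nonneg ‖d‖]))
  have hn : ‖ncDirection g H d‖ = -c / ‖d‖ ^ 2 := by
    rw [ncDirection, norm_smul, norm_smul, norm_neg, norm_mul, norm_inv, norm_norm,
      inv_mul_cancel₀ hd0.ne', Real.norm_eq_abs, Real.norm_eq_abs, abs_sgn, abs_div, abs_abs,
      one_mul, mul_one, abs_of_pos (pow_pos hd0 2), hc]
  refine ⟨?_, ?_⟩
  · rw [hn, le_div_iff₀ (by positivity)]; linarith
  · have h := sgn_mul_self (inner ℝ d g)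
    rw [hn, ncDirection]
    simp only [map_smul, real_inner_smul_left, real_inner_smul_right, ← hcdef, hc]
    field_simp
    linear_combination c ^ 3 * h

/-- The gradient at the point reached by a short approximate damped Newton step. -/
theorem norm_gradient_newtonStep_le (hs : SmoothOn f x₀ flow B Lg LH) (hε : 0 < ε)
    (hεH : prm.εH = √(LH * ε)) {x d g : Vec n} {H : Mat n} (hHM : ‖H‖ ≤ prm.UH)
    (hB : segment ℝ x (x + d) ⊆ B) (hd : prm.εH * ‖d‖ ≤ ε)
    (hr : ‖g + CappedCG.damped H prm.εH d‖ ≤ CappedCG.zetaHat prm.UH prm.εH prm.ζ * ‖g‖)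
    (hg : ‖g - gradient f x‖ ≤ (1 - prm.ζ) / 8 * ε)
    (hH : ‖H - hessian f x‖ ≤ (1 - prm.ζ) / 4 * prm.εH) :
    ‖gradient f (x + d)‖ ≤ 4 * ε := by
  have hLH := hs.LH_pos
  have hζ := prm.ζ_pos
  have hζ1 := prm.ζ_lt_one
  have hεH0 := prm.εH_pos
  have hUH := prm.UH_pos
  have hεsq : prm.εH ^ 2 = LH * ε := by rw [hεH, Real.sq_sqrt (by positivity)]
  set e := prm.εH
  set r := g + CappedCG.damped H e d with hrdef
  have hκ := CappedCG.two_le_kappa hεH0 hUH.le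
  set κ := CappedCG.kappa prm.UH e with hκdef
  have hκe : prm.UH + 2 * e = κ * e := by rw [hκdef, CappedCG.kappa]; field_simp
  -- From `3κ‖r‖ ≤ ‖g‖ ≤ ‖r‖ + κ ε` and `‖r‖ ≤ (κ/2)‖r‖`, as `κ ≥ 2`.
  have hr' : ‖r‖ ≤ 2 / 5 * ε := by
    have h₁ : ‖g‖ ≤ ‖r‖ + κ * e * ‖d‖ := by
      have h₂ : g = r - CappedCG.damped H e d := by rw [hrdef]; abel
      have h₃ := CappedCG.norm_damped_le hεH0.le hHM d
      rw [hκe] at h₃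
      calc ‖g‖ = ‖r - CappedCG.damped H e d‖ := by rw [← h₂]
        _ ≤ ‖r‖ + ‖CappedCG.damped H e d‖ := norm_sub_le _ _
        _ ≤ _ := by linarith
    have h₄ : ‖r‖ * (3 * κ) ≤ ‖g‖ := by
      have h₅ : CappedCG.zetaHat prm.UH e prm.ζ = prm.ζ / (3 * κ) := rfl
      rw [h₅, div_mul_eq_mul_div, le_div_iff₀ (by positivity)] at hr
      nlinarith [norm_nonneg g]
    have h₆ : ‖r‖ * (5 / 2 * κ) ≤ ε * κ := by nlinarith [norm_nonneg r]
    nlinarith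
  have hquad : LH * ‖d‖ ^ 2 ≤ ε := by
    have : (e * ‖d‖) ^ 2 ≤ ε ^ 2 := pow_le_pow_left₀ (by positivity) hd 2
    rw [mul_pow, hεsq] at this
    nlinarith
  have ht := norm_gradient_sub_le hs.smooth hLH.le hs.lipHess hB
  have hHd : ‖(H - hessian f x) d‖ ≤ 1 / 4 * ε := by
    refine ((H - hessian f x).le_of_opNorm_le hH d).trans ?_
    nlinarith [norm_nonneg d, mul_nonneg hζ.le (mul_nonneg hεH0.le (norm_nonneg d))]
  have hgd : ‖g - gradient f x‖ ≤ 1 / 8 * ε := hg.trans (by nlinarith)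
  have hed : ‖(2 * e) • d‖ ≤ 2 * ε := by
    rw [norm_smul, Real.norm_of_nonneg (by positivity)]; linarith
  -- The five pieces contribute `1 + 1/8 + 1/4 + 2/5 + 2 < 4` times `ε`.
  have hsplit : gradient f (x + d) = (gradient f (x + d) - gradient f x - hessian f x d)
      - (g - gradient f x) - (H - hessian f x) d + r - (2 * e) • d := by
    rw [hrdef, CappedCG.damped, sub_apply]; abel
  rw [hsplit]
  refine (norm_sub_le _ _).trans ?_
  have a₁ := norm_add_le ((gradient f (x + d) - gradient f x - hessian f x d)
      - (g - gradient f x) - (H - hessian f x) d) r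
  have a₂ := norm_sub_le ((gradient f (x + d) - gradient f x - hessian f x d)
      - (g - gradient f x)) ((H - hessian f x) d)
  have a₃ := norm_sub_le (gradient f (x + d) - gradient f x - hessian f x d) (g - gradient f x)
  linarith

theorem neg_le_lambdaMin_of_near {A H : Mat n} {e c : ℝ} (he : 0 ≤ e) (hc : 0 ≤ c)
    (hH : ∀ v, -e * ‖v‖ ^ 2 ≤ inner ℝ v (H v)) (hAH : ‖A - H‖ ≤ c) :
    -(e + c) ≤ lambdaMin A := by
  refine neg_le_lambdaMin (by positivity) fun v => ?_
  have h := (abs_le.1 (abs_inner_apply_le (A - H) v)).1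
  rw [sub_apply, inner_sub_right] at h
  have := mul_le_mul_of_nonneg_right hAH (sq_nonneg ‖v‖)
  linarith [hH v]

/-- An iteration that is reached either decreases `f` or returns an approximate stationary point,
after a call of the minimum eigenvalue oracle that issued a certificate. -/
theorem iteration_cases {D : Data n} (hs : SmoothOn f x₀ flow B Lg LH) (hε : 0 < ε)
    (hεg : prm.εg = ε) (hεH : prm.εH = √(LH * ε)) (hE : IsExecution f prm x₀ D)
    (hC : ContainsSegments f prm x₀ D B) (hA : Accurate f prm x₀ D) {k : ℕ} {x : Vec n}
    (hx : D.status f prm x₀ k = Status.running x) :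
    (∃ x', iteration f prm x (D.decisionAt prm k) = Status.running x' ∧
        f x' + decreaseCoeff prm LH * ε ^ (3 / 2 : ℝ) ≤ f x) ∨
      ∃ z, iteration f prm x (D.decisionAt prm k) = Status.returned z ∧
        ‖gradient f z‖ ≤ 4 * ε ∧ CallsMEO prm (D.g k) (D.cg k) ∧ D.meo k = none ∧
        ((∀ v, -prm.εH * ‖v‖ ^ 2 ≤ inner ℝ v (D.H k v)) →
          -(4 * prm.εH) ≤ lambdaMin (hessian f z)) := by
  have hLH := hs.LH_pos
  have hζ := prm.ζ_pos
  have hζ1 := prm.ζ_lt_one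
  have hεH0 := prm.εH_pos
  have hεsq : prm.εH ^ 2 = LH * ε := by rw [hεH, Real.sq_sqrt (by positivity)]
  have hseg := hC k x hx
  obtain ⟨hgacc, hHacc⟩ := hA k x hx
  have hHsymm := hE.symm k x hx
  have hHM := hE.bound k x hx
  have hnear : ‖hessian f x - D.H k‖ ≤ prm.εH := by
    rw [norm_sub_rev]; nlinarith
  have search : ∀ d, D.decisionAt prm k = Decision.search DType.NC d → prm.εH / 2 ≤ ‖d‖ →
      inner ℝ d (D.H k d) = -‖d‖ ^ 3 →
      ∃ x', iteration f prm x (D.decisionAt prm k) = Status.running x' ∧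
        f x' + decreaseCoeff prm LH * ε ^ (3 / 2 : ℝ) ≤ f x := by
    intro d hdec h₁ h₂
    rw [hdec] at hseg
    obtain ⟨α, hα, hdecr⟩ := decrease_NC hs hε hεH (hseg d (Or.inl rfl))
      (hseg (-d) (Or.inr rfl)) h₁ h₂ hHacc
    refine ⟨x + α • d, ?_, hdecr⟩
    rw [hdec]
    simp only [iteration, hα]
  have oracle : ∀ v, D.meo k = some v → CallsMEO prm (D.g k) (D.cg k) →
      D.decisionAt prm k = Decision.search DType.NC (meoDirection (D.g k) (D.H k) v) →
      ∃ x', iteration f prm x (D.decisionAt prm k) = Status.running x' ∧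
        f x' + decreaseCoeff prm LH * ε ^ (3 / 2 : ℝ) ≤ f x := by
    intro v hv hcall hdec
    have h := hE.meo k ⟨⟨x, hx⟩, hcall⟩
    rw [hv] at h
    obtain ⟨h₁, h₂⟩ := meoDirection_spec (D.g k) hεH0 h.1 h.2
    exact search _ hdec h₁ h₂
  by_cases hg : prm.εg ≤ ‖D.g k‖
  · have hout := hE.cg k x hx hg
    have hg0 : D.g k ≠ 0 := by
      intro h; rw [h, norm_zero, hεg] at hg; linarith
    rcases hcg : D.cg k with _ | ⟨_ | _, d⟩
    · rw [hcg] at hout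
      obtain ⟨t, d, h⟩ := CappedCG.exists_returns hεH0 hHM hζ.le hHsymm hg0
      exact absurd h (hout t d)
    · rw [hcg] at hout
      obtain ⟨hcurv, hgd, hr⟩ := CappedCG.Returns.newtonStep hεH0 hHM hζ.le hHsymm hg0 hout
      rw [CappedCG.inner_damped] at hgd
      by_cases hd : ‖d‖ ≤ prm.εg / prm.εH
      · have hcall : CallsMEO prm (D.g k) (D.cg k) := Or.inr ⟨d, hcg, hd⟩
        rcases hmeo : D.meo k with _ | v
        · right
          have hdec : D.decisionAt prm k = Decision.stopAfter d := by
            simp [Data.decisionAt, decision, hg, hcg, hd, hmeo]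
          rw [hdec] at hseg ⊢
          simp only [gradTolerance, hdec, hεg] at hgacc
          rw [le_div_iff₀ hεH0, hεg, mul_comm] at hd
          have hB := hseg d rfl
          rw [← hcg]
          refine ⟨x + d, rfl, norm_gradient_newtonStep_le hs hε hεH hHM hB hd hr hgacc hHacc,
            hcall, rfl, fun hv => ?_⟩
          -- The step moves the Hessian by at most `εH`, as `εH ‖d‖ ≤ ε` and `εH² = LH ε`. With the
          -- error of `H` and the certificate this makes `3 εH`.
          have h₁ : LH * ‖d‖ ≤ prm.εH := by
            have : prm.εH * (LH * ‖d‖) ≤ prm.εH * prm.εH := by nlinarith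
            exact le_of_mul_le_mul_left this hεH0
          have h₂ := hs.lipHess _ (hB (right_mem_segment ℝ _ _)) _ (hB (left_mem_segment ℝ _ _))
          rw [add_sub_cancel_left] at h₂
          have h₃ : ‖hessian f (x + d) - D.H k‖ ≤ 2 * prm.εH :=
            (norm_sub_le_norm_sub_add_norm_sub _ (hessian f x) _).trans (by linarith)
          have := neg_le_lambdaMin_of_near hεH0.le (by positivity) hv h₃
          linarith
        · left
          exact oracle v hmeo hcall (by simp [Data.decisionAt, decision, hg, hcg, hd, hmeo])
      · left
        have hdec : D.decisionAt prm k = Decision.search DType.SOL d := by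
          simp [Data.decisionAt, decision, hg, hcg, hd]
        rw [hdec] at hseg ⊢
        simp only [gradTolerance, hdec, hεg] at hgacc
        rw [not_le, div_lt_iff₀ hεH0, hεg, mul_comm] at hd
        -- A long step makes the tolerance at most `εH ‖d‖`, whatever `g (k+1)` is.
        have htol : max ε (min (prm.εH * ‖d‖) (min ‖D.g k‖ ‖D.g (k + 1)‖)) ≤ prm.εH * ‖d‖ :=
          max_le hd.le (min_le_left _ _)
        obtain ⟨α, hα, hdecr⟩ := decrease_SOL hs hε hεH (hseg d rfl) hd hcurv hgd
          (hgacc.trans (mul_le_mul_of_nonneg_left htol (by linarith))) hHacc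
        exact ⟨x + α • d, by simp only [iteration, hα], hdecr⟩
    · left
      rw [hcg] at hout
      obtain ⟨hd0, hcurv⟩ := CappedCG.Returns.negCurv hεH0 hHM hζ.le hHsymm hg0 hout
      obtain ⟨h₁, h₂⟩ := ncDirection_spec (D.g k) hεH0 hd0 hcurv
      exact search _ (by simp [Data.decisionAt, decision, hg, hcg]) (by linarith) h₂
  · have hcall : CallsMEO prm (D.g k) (D.cg k) := Or.inl (not_le.1 hg)
    rcases hmeo : D.meo k with _ | v
    · right
      have hdec : D.decisionAt prm k = Decision.stopHere := by
        simp [Data.decisionAt, decision, hg, hmeo]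
      rw [hdec]
      simp only [gradTolerance, hdec, hεg] at hgacc
      refine ⟨x, rfl, ?_, hcall, rfl, fun hv => ?_⟩
      · have h₁ : ‖gradient f x‖ ≤ ‖D.g k‖ + ‖D.g k - gradient f x‖ := by
          rw [norm_sub_rev]
          exact norm_le_norm_add_norm_sub' _ _
        rw [hεg, not_le] at hg
        nlinarith
      · have := neg_le_lambdaMin_of_near hεH0.le hεH0.le hv hnear
        linarith
    · left
      exact oracle v hmeo hcall (by simp [Data.decisionAt, decision, hg, hmeo])

end NewtonCG

/-! ### Whole runs: termination and the final certificate -/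

namespace NewtonCG

section Run

variable {n : ℕ} {f : Vec n → ℝ} {prm : Params} {x₀ : Vec n} {flow : ℝ} {B : Set (Vec n)}
  {Lg LH ε : ℝ} {D : Data n}

theorem status_succ_of_running {k : ℕ} {x : Vec n} (h : D.status f prm x₀ k = Status.running x) :
    D.status f prm x₀ (k + 1) = iteration f prm x (D.decisionAt prm k) := by
  rw [Data.status, h]

theorem status_of_returned {j k : ℕ} {z : Vec n} (h : D.status f prm x₀ j = Status.returned z)
    (hjk : j ≤ k) : D.status f prm x₀ k = Status.returned z := by
  induction k, hjk using Nat.le_induction with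
  | base => exact h
  | succ k _ ih => rw [Data.status, ih]

theorem decrease_of_running (hs : SmoothOn f x₀ flow B Lg LH) (hε : 0 < ε)
    (hεg : prm.εg = ε) (hεH : prm.εH = √(LH * ε)) (hE : IsExecution f prm x₀ D)
    (hC : ContainsSegments f prm x₀ D B) (hA : Accurate f prm x₀ D) (k : ℕ) :
    (∃ x, D.status f prm x₀ k = Status.running x ∧
      f x + k * (decreaseCoeff prm LH * ε ^ (3 / 2 : ℝ)) ≤ f x₀) ∨
    ∃ z, D.status f prm x₀ k = Status.returned z := by
  induction k with
  | zero => exact Or.inl ⟨x₀, rfl, by simp⟩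
  | succ k ih =>
    rcases ih with ⟨x, hx, hfx⟩ | ⟨z, hz⟩
    · rcases iteration_cases hs hε hεg hεH hE hC hA hx with ⟨x', h₁, h₂⟩ | ⟨z, h₁, -⟩
      · exact Or.inl ⟨x', by rw [status_succ_of_running hx, h₁], by push_cast; linarith⟩
      · exact Or.inr ⟨z, by rw [status_succ_of_running hx, h₁]⟩
    · exact Or.inr ⟨z, status_of_returned hz k.le_succ⟩

theorem exists_returned (hs : SmoothOn f x₀ flow B Lg LH) (hε : 0 < ε)
    (hεg : prm.εg = ε) (hεH : prm.εH = √(LH * ε)) (hE : IsExecution f prm x₀ D)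
    (hC : ContainsSegments f prm x₀ D B) (hA : Accurate f prm x₀ D) :
    ∃ z, D.status f prm x₀ (iterBound prm LH (f x₀ - flow) ε) = Status.returned z := by
  rcases decrease_of_running hs hε hεg hεH hE hC hA (iterBound prm LH (f x₀ - flow) ε) with
    ⟨x, -, hfx⟩ | h
  · exfalso
    set m := decreaseCoeff prm LH with hm
    set q := ε ^ (3 / 2 : ℝ) with hq
    have hm0 : 0 < m := decreaseCoeff_pos hs.LH_pos
    have hq0 : 0 < q := by positivity
    have hqinv : ε ^ (-(3 / 2) : ℝ) = q⁻¹ := Real.rpow_neg hε.le _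
    -- Any `K` with `K * m * q > f x₀ - flow` would do; the `3` and the `5` are slack.
    have hK : 3 * (f x₀ - flow) / m * q⁻¹ + 5 ≤ (iterBound prm LH (f x₀ - flow) ε : ℕ) := by
      rw [iterBound, ← hqinv]
      push_cast
      gcongr
      exact Nat.le_ceil _
    have h₁ := mul_le_mul_of_nonneg_right hK (mul_pos hm0 hq0).le
    have h₂ : (3 * (f x₀ - flow) / m * q⁻¹ + 5) * (m * q) = 3 * (f x₀ - flow) + 5 * (m * q) := by
      field_simp
    have h₃ := hs.lower x
    have h₄ := hs.lower x₀
    have h₅ := mul_pos hm0 hq0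
    linarith
  · exact h

/-- A run that has returned did so at an iteration with a certificate of the oracle. -/
theorem exists_final_iteration (hs : SmoothOn f x₀ flow B Lg LH) (hε : 0 < ε)
    (hεg : prm.εg = ε) (hεH : prm.εH = √(LH * ε)) (hE : IsExecution f prm x₀ D)
    (hC : ContainsSegments f prm x₀ D B) (hA : Accurate f prm x₀ D) {K : ℕ} {z : Vec n}
    (hz : D.status f prm x₀ K = Status.returned z) :
    ‖gradient f z‖ ≤ 4 * ε ∧ ∃ k < K, D.CallsMEOAt f prm x₀ k ∧ D.meo k = none ∧
      ((∀ v, -prm.εH * ‖v‖ ^ 2 ≤ inner ℝ v (D.H k v)) →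
        -(4 * prm.εH) ≤ lambdaMin (hessian f z)) := by
  induction K with
  | zero => simp [Data.status] at hz
  | succ K ih =>
    rcases hK : D.status f prm x₀ K with x | z' | _
    · rw [status_succ_of_running hK] at hz
      rcases iteration_cases hs hε hεg hεH hE hC hA hK with ⟨x', h₁, -⟩ | ⟨z', h₁, h₂, h₃, h₄, h₅⟩
      · simp [h₁] at hz
      · rw [h₁, Status.returned.injEq] at hz
        subst hz
        exact ⟨h₂, K, K.lt_succ_self, ⟨⟨x, hK⟩, h₃⟩, h₄, h₅⟩
    · rw [Data.status, hK] at hz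
      obtain ⟨h₁, k, hk, h₂⟩ := ih (hK.trans hz)
      exact ⟨h₁, k, hk.trans K.lt_succ_self, h₂⟩
    · rw [Data.status, hK] at hz
      simp at hz

/-- A certificate ends the run. -/
theorem not_running_after_certificate {i k : ℕ} (hi : D.CallsMEOAt f prm x₀ i)
    (hmeo : D.meo i = none) (hik : i < k) : ¬ D.CallsMEOAt f prm x₀ k := by
  rintro ⟨⟨x', hx'⟩, -⟩
  obtain ⟨⟨x, hx⟩, hcall⟩ := hi
  have hret : ∃ z, D.status f prm x₀ (i + 1) = Status.returned z := by
    rw [status_succ_of_running hx, Data.decisionAt]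
    unfold decision
    rw [hmeo]
    split_ifs with hg
    · obtain ⟨d, hcg, hd⟩ := hcall.resolve_left (not_lt.2 hg)
      rw [hcg]
      simp only [if_pos hd]
      exact ⟨_, rfl⟩
    · exact ⟨_, rfl⟩
  obtain ⟨z, hz⟩ := hret
  rw [status_of_returned hz hik] at hx'
  simp at hx'

end Run

/-! ### Probability of a wrong certificate -/

section Probability

variable {Ω : Type*} {mΩ : MeasurableSpace Ω} {P : Measure Ω}

/-- If an event `C` has conditional probability at most `δ` on an event `G` of the conditioning
σ-algebra, then `G ∩ C` has probability at most `δ P(G)`. -/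
theorem measureReal_inter_le_of_condExp_le [IsProbabilityMeasure P] {m : MeasurableSpace Ω}
    (hm : m ≤ mΩ) {G C : Set Ω} (hG : MeasurableSet[m] G) (hC : MeasurableSet[mΩ] C) {δ : ℝ}
    (h : ∀ᵐ ω ∂P, ω ∈ G → condExp m P (C.indicator fun _ => (1 : ℝ)) ω ≤ δ) :
    P.real (G ∩ C) ≤ δ * P.real G := by
  have hint : Integrable (C.indicator fun _ => (1 : ℝ)) P :=
    (integrable_const 1).indicator hC
  calc P.real (G ∩ C) = ∫ ω in G, C.indicator (fun _ => (1 : ℝ)) ω ∂P := by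
        rw [setIntegral_indicator hC, setIntegral_const, smul_eq_mul, mul_one]
    _ = ∫ ω in G, condExp m P (C.indicator fun _ => (1 : ℝ)) ω ∂P :=
        (setIntegral_condExp hm hint hG).symm
    _ ≤ ∫ _ω in G, δ ∂P := by
        refine setIntegral_mono_ae_restrict integrable_condExp.integrableOn
          (integrable_const δ).integrableOn ?_
        exact (ae_restrict_iff' (hm _ hG)).2 h
    _ = δ * P.real G := by rw [setIntegral_const, smul_eq_mul, mul_comm]

/-- Successive failures, each of conditional probability at most `δ` and possible only if no
failure occurred before. -/
theorem pow_le_measureReal_compl_iUnion [IsProbabilityMeasure P] {G A : ℕ → Set Ω} {δ : ℝ}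
    (hδ0 : 0 ≤ δ) (hδ1 : δ ≤ 1) (hA : ∀ k, MeasurableSet (A k))
    (hAG : ∀ k, P.real (A k) ≤ δ * P.real (G k))
    (hdisj : ∀ k, ∀ i < k, Disjoint (G k) (A i)) (K : ℕ) :
    (1 - δ) ^ K ≤ P.real (⋃ i < K, A i)ᶜ := by
  induction K with
  | zero => simp
  | succ K ih =>
    have hU : ∀ k, MeasurableSet (⋃ i < k, A i) := fun k =>
      MeasurableSet.iUnion fun i => MeasurableSet.iUnion fun _ => hA i
    have h₁ : (⋃ i < K + 1, A i)ᶜ = (⋃ i < K, A i)ᶜ \ A K := by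
      rw [Set.biUnion_lt_succ, Set.compl_union, Set.sdiff_eq]
    have h₂ : P.real (⋃ i < K, A i)ᶜ - P.real (A K) ≤ P.real ((⋃ i < K, A i)ᶜ \ A K) :=
      le_measureReal_sdiff
    -- `G K` excludes all earlier failures, so the new failure removes at most the fraction `δ` of
    -- the surviving event.
    have h₃ : P.real (G K) ≤ P.real (⋃ i < K, A i)ᶜ := by
      refine measureReal_mono fun ω hω => ?_
      simp only [Set.mem_compl_iff, Set.mem_iUnion, not_exists]
      exact fun i hi hωA => Set.disjoint_left.1 (hdisj K i hi) hω hωA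
    rw [h₁, pow_succ]
    have h₄ := mul_le_mul_of_nonneg_left h₃ hδ0
    have h₅ := mul_le_mul_of_nonneg_right ih (sub_nonneg.2 hδ1)
    linarith [hAG K]

/-- Makes "`H k` has curvature below `-εH`" an event of `ℱ k` without measurability of `lambdaMin`.
-/
theorem isOpen_exists_curvature_lt (n : ℕ) (c : ℝ) :
    IsOpen {A : Mat n | ∃ v, inner ℝ v (A v) < c * ‖v‖ ^ 2} := by
  rw [Set.ofPred_exists]
  refine isOpen_iUnion fun v => isOpen_lt ?_ continuous_const
  fun_prop

end Probability

/-- With probability at least `(1 - δ)^K`, the first `K` iterations see no wrong certificate. -/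
theorem exists_reliable_event {n : ℕ} {f : Vec n → ℝ} {prm : Params} {x₀ : Vec n}
    {Ω : Type*} {mΩ : MeasurableSpace Ω} {P : Measure Ω} [IsProbabilityMeasure P]
    {ℱ : Filtration ℕ mΩ} {D : Ω → Data n} {δ : ℝ} (hδ0 : 0 ≤ δ) (hδ1 : δ ≤ 1)
    (hE : ∀ ω, IsExecution f prm x₀ (D ω)) (hO : OracleReliable P ℱ f prm x₀ D δ) (K : ℕ) :
    ∃ S : Set Ω, MeasurableSet S ∧ (1 - δ) ^ K ≤ P.real S ∧ ∀ ω ∈ S, ∀ k < K,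
      (D ω).CallsMEOAt f prm x₀ k → (D ω).meo k = none →
        ∀ v, -prm.εH * ‖v‖ ^ 2 ≤ inner ℝ v ((D ω).H k v) := by
  let C : ℕ → Set Ω := fun k => {ω | (D ω).CallsMEOAt f prm x₀ k ∧ (D ω).meo k = none}
  -- `G k` says that the oracle is called on a matrix that deserves no certificate; `G k ∩ C k` is a
  -- wrong certificate.
  let G : ℕ → Set Ω := fun k => {ω | (D ω).CallsMEOAt f prm x₀ k} ∩
    {ω | ∃ v, inner ℝ v ((D ω).H k v) < -prm.εH * ‖v‖ ^ 2}
  have hG : ∀ k, MeasurableSet[ℱ k] (G k) := fun k =>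
    (hO.measurable_calls k).inter
      (hO.measurable_H k (isOpen_exists_curvature_lt n (-prm.εH)).measurableSet)
  have hC : ∀ k, MeasurableSet (C k) := hO.measurable_certified
  have hA : ∀ k, MeasurableSet (G k ∩ C k) := fun k => (ℱ.le k _ (hG k)).inter (hC k)
  refine ⟨(⋃ i < K, G i ∩ C i)ᶜ, (MeasurableSet.iUnion fun i => MeasurableSet.iUnion
    fun _ => hA i).compl, pow_le_measureReal_compl_iUnion (G := G) hδ0 hδ1 hA (fun k => ?_)
    (fun k i hik => ?_) K, fun ω hω k hk hcall hmeo v => ?_⟩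
  · refine measureReal_inter_le_of_condExp_le (ℱ.le k) (hG k) (hC k) ?_
    filter_upwards [hO.failure k] with ω hω hωG
    obtain ⟨hcall, v, hv⟩ := hωG
    obtain ⟨x, hx⟩ := hcall.1
    exact hω hcall (lambdaMin_lt ((hE ω).symm k x hx) hv)
  · rw [Set.disjoint_left]
    exact fun ω hk hi => not_running_after_certificate hi.2.1 hi.2.2 hik hk.1
  · by_contra! hv
    refine hω ?_
    simp only [Set.mem_iUnion]
    exact ⟨k, hk, ⟨hcall, v, hv⟩, hcall, hmeo⟩

end NewtonCG

theorem theorem1 :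
    ∃ C₁ C₂ : ℝ, 0 < C₁ ∧ 0 < C₂ ∧
      ∀ (n : ℕ) (f : Vec n → ℝ) (x₀ : Vec n) (flow : ℝ) (B : Set (Vec n)) (Lg LH : ℝ)
        (_ : NewtonCG.SmoothOn f x₀ flow B Lg LH)
        (ε : ℝ) (_ : 0 < ε)
        (prm : NewtonCG.Params) (_ : prm.εg = ε) (_ : prm.εH = √(LH * ε))
        (δ : ℝ) (_ : 0 ≤ δ) (_ : δ < 1)
        (Ω : Type*) (mΩ : MeasurableSpace Ω) (P : MeasureTheory.Measure Ω)
        (_ : MeasureTheory.IsProbabilityMeasure P) (ℱ : MeasureTheory.Filtration ℕ mΩ)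
        (D : Ω → NewtonCG.Data n)
        (_ : ∀ ω, NewtonCG.IsExecution f prm x₀ (D ω))
        (_ : ∀ ω, NewtonCG.ContainsSegments f prm x₀ (D ω) B)
        (_ : ∀ ω, NewtonCG.Accurate f prm x₀ (D ω))
        (_ : NewtonCG.OracleReliable P ℱ f prm x₀ D δ),
        ∃ z : Ω → Vec n,
          (∀ ω, (D ω).status f prm x₀ (NewtonCG.iterBound prm LH (f x₀ - flow) ε) =
              NewtonCG.Status.returned (z ω) ∧
            ‖gradient f (z ω)‖ ≤ C₁ * ε) ∧
          ∃ S : Set Ω, MeasurableSet S ∧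
            (1 - δ) ^ NewtonCG.iterBound prm LH (f x₀ - flow) ε ≤ P.real S ∧
            ∀ ω ∈ S, -(C₂ * √(LH * ε)) ≤ lambdaMin (hessian f (z ω)) := by
  refine ⟨4, 4, by norm_num, by norm_num, ?_⟩
  intro n f x₀ flow B Lg LH hs ε hε prm hεg hεH δ hδ0 hδ1 Ω mΩ P hP ℱ D hE hC hA hO
  choose z hz using fun ω => NewtonCG.exists_returned hs hε hεg hεH (hE ω) (hC ω) (hA ω)
  have hfinal := fun ω =>
    NewtonCG.exists_final_iteration hs hε hεg hεH (hE ω) (hC ω) (hA ω) (hz ω)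
  refine ⟨z, fun ω => ⟨hz ω, (hfinal ω).1⟩, ?_⟩
  obtain ⟨S, hS, hPS, hSω⟩ := NewtonCG.exists_reliable_event hδ0 hδ1.le hE hO
    (NewtonCG.iterBound prm LH (f x₀ - flow) ε)
  refine ⟨S, hS, hPS, fun ω hω => ?_⟩
  obtain ⟨-, k, hk, hcall, hmeo, hlow⟩ := hfinal ω
  rw [← hεH]
  exact hlow (hSω ω hω k hk hcall hmeo)
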